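/- Let $\mathcal V$ be a finite or countably infinite set of vertices and let $k\ge 1$. A $k$-hypergraph on $\mathcal V$ is a function $g:\mathcal V^k\to\{0,1\}$, and a $k$-distinguishing class is a non-empty set $\mathcal G$ of $k$-hypergraphs that are undirected, i.e. invariant under permutations of their $k$ arguments. For a probability distribution $p$ on $\mathcal V$ let $L_p(g)=\mathbb E_{v_1,\dots,v_k\sim p\ \mathrm{iid}}[g(v_1,\dots,v_k)]$, and for a sample $S=(s_1,\dots,s_m)$ let $L_S(g)=m^{-k}\sum_{i_1,\dots,i_k=1}^m g(s_{i_1},\dots,s_{i_k})$. Let $\mathrm{IPM}_{\mathcal G}(p_1,p_2)=\sup_{g\in\mathcal G}|L_{p_1}(g)-L_{p_2}(g)|$. The graph VC dimension $\mathrm{gVC}(\mathcal G)$ is the VC dimension of $\mathcal G$ if $k=1$, and $\mathrm{gVC}(\mathcal G)=\sup_{v\in\mathcal V}\mathrm{gVC}(\{g(v,\cdot,\dots,\cdot):g\in\mathcal G\})$ if $k>1$. An algorithm $A$, which maps a pair of finite samples $(S_1,S_2)$ of vertices to an element $A(S_1,S_2)$ of $\mathcal G$, discriminates with accuracy $\varepsilon$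 and confidence $\delta$ from more than $M$ samples if for all probability distributions $p_1,p_2$ on $\mathcal V$ and all sizes $m_1,m_2>M$, when $S_1\sim p_1^{m_1}$ and $S_2\sim p_2^{m_2}$ are independent, with probability at least $1-\delta$ the output $g=A(S_1,S_2)$ satisfies \[|L_{p_1}(g)-L_{p_2}(g)|>\mathrm{IPM}_{\mathcal G}(p_1,p_2)-\varepsilon .\] The sample complexity $m_{\mathcal G}(\varepsilon,\delta)$ of $\mathcal G$ is the smallest $m\in\mathbb N$ for which some algorithm discriminates with accuracy $\varepsilon$ and confidence $\delta$ from more than $m$ samples ($\infty$ if there is none). Theorem (Sample complexity, upper bound). There is an absolute constant $C>0$ such that for every finite or countable $\mathcal V$, every $k\ge 1$ and every $k$-distinguishing class $\mathcal G$ on $\mathcal V$ with $\mathrm{gVC}(\mathcal G)=\rho<\infty$, the following holds. 1. For all $\varepsilon>0$ and $0<\delta\le 1/2$, \[m_{\mathcal G}(\varepsilon,\delta)\le C\,\frac{\rho k^2}{\varepsilon^2}\log\frac1\delta .\] 2. There is an empirical IPM maximizer, that is, an algorithm whose output always belongs to $\mathcal G$ and maximizes $|L_{S_1}(g)-L_{S_2}(g)|$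 over $g\in\mathcal G$; and every empirical IPM maximizer discriminates, for all $\varepsilon>0$ and $0<\delta\le 1/2$, with accuracy $\varepsilon$ and confidence $\delta$ from more than $C\frac{\rho k^2}{\varepsilon^2}\log\frac1\delta$ samples. -/

import Mathlib

open MeasureTheory
open scoped ENNReal

noncomputable section

namespace GraphDisc

/-- A `k`-hypergraph on the vertex set `V` is identified with its set of hyperedges, a set of
`k`-tuples of vertices. It is undirected if that set is invariant under permuting the entries of
the tuples. -/
def Undirected {V : Type*} {k : ℕ} (g : Set (Fin k → V)) : Prop :=
  ∀ (π : Equiv.Perm (Fin k)) (v : Fin k → V), (fun i => v (π i)) ∈ g ↔ v ∈ g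

/-- A `k`-distinguishing class is a collection of undirected `k`-hypergraphs on `V`. -/
def IsDistinguishingClass {V : Type*} {k : ℕ} (G : Set (Set (Fin k → V))) : Prop :=
  ∀ g ∈ G, Undirected g

/-- The family `D` of subsets of `α` shatters the finite set `S`: every subset of `S` is the trace
on `S` of a member of `D`. -/
def ShattersSet {α : Type*} (D : Set (Set α)) (S : Finset α) : Prop :=
  ∀ T : Set α, T ⊆ S → ∃ d ∈ D, d ∩ S = T

/-- The VC dimension: the supremum of the sizes of the finite shattered sets. -/
def VCdim {α : Type*} (D : Set (Set α)) : ℕ∞ :=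
  ⨆ (S : Finset α) (_ : ShattersSet D S), (S.card : ℕ∞)

/-- The `k`-hypergraph `g_v` obtained from a `(k+1)`-hypergraph `g` by fixing the first entry of
the tuples to be `v`. -/
def fixFirst {V : Type*} {k : ℕ} (v : V) (g : Set (Fin (k + 1) → V)) : Set (Fin k → V) :=
  {u | (Fin.cons v u : Fin (k + 1) → V) ∈ g}

/-- The graph VC dimension of a family of `k`-hypergraphs. For `k = 1` it is the VC dimension of
the family of subsets of `V` that are identified with the `1`-hypergraphs of the family; for
larger `k` it is the supremum over `v` of the graph VC dimension of `{g_v : g ∈ G}`. The case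
`k = 0` is a placeholder. -/
def gVC {V : Type*} : (k : ℕ) → Set (Set (Fin k → V)) → ℕ∞
  | 0, _ => 0
  | 1, G => VCdim ((fun g : Set (Fin 1 → V) => {x : V | (fun _ => x) ∈ g}) '' G)
  | k + 2, G => ⨆ v : V, gVC (k + 1) (fixFirst v '' G)

/-- The frequency of an edge of `g` with respect to `p`: the probability that `k` independent
draws from `p` form a hyperedge. -/
def edgeFreq {V : Type*} [MeasurableSpace V] {k : ℕ} (p : Measure V) (g : Set (Fin k → V)) : ℝ :=
  (Measure.pi (fun _ : Fin k => p)).real g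

/-- The empirical frequency of an edge of `g` in the sample `S`: the average of the indicator of
`g` over the `m ^ k` tuples of (not necessarily distinct) sample points. -/
def empFreq {V : Type*} {k m : ℕ} (S : Fin m → V) (g : Set (Fin k → V)) : ℝ :=
  (∑ i : Fin k → Fin m, g.indicator (fun _ => (1 : ℝ)) (fun j => S (i j))) / (m : ℝ) ^ k

/-- The integral probability metric induced by `G`. -/
def IPM {V : Type*} [MeasurableSpace V] {k : ℕ} (G : Set (Set (Fin k → V)))
    (p₁ p₂ : Measure V) : ℝ :=
  ⨆ g : G, |edgeFreq p₁ (g : Set (Fin k → V)) - edgeFreq p₂ (g : Set (Fin k → V))|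

/-- A rule that takes two finite samples of vertices to a `k`-hypergraph. -/
abbrev Algo (V : Type*) (k : ℕ) : Type _ :=
  ∀ m₁ m₂ : ℕ, (Fin m₁ → V) → (Fin m₂ → V) → Set (Fin k → V)

/-- The rule `A` outputs members of `G`, and whenever the two samples are drawn IID from `p₁` and
`p₂` and both have size larger than `M`, then with probability at least `1 - δ` the output `g`
satisfies `|L_{p₁}(g) - L_{p₂}(g)| > IPM_G(p₁, p₂) - ε`. -/
def Discriminates {V : Type*} [MeasurableSpace V] {k : ℕ} (G : Set (Set (Fin k → V)))
    (A : Algo V k) (ε δ M : ℝ) : Prop :=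
  (∀ (m₁ m₂ : ℕ) (S₁ : Fin m₁ → V) (S₂ : Fin m₂ → V), A m₁ m₂ S₁ S₂ ∈ G) ∧
  ∀ (p₁ p₂ : Measure V), IsProbabilityMeasure p₁ → IsProbabilityMeasure p₂ →
    ∀ m₁ m₂ : ℕ, M < m₁ → M < m₂ →
      1 - δ ≤ ((Measure.pi (fun _ : Fin m₁ => p₁)).prod (Measure.pi (fun _ : Fin m₂ => p₂))).real
        {S : (Fin m₁ → V) × (Fin m₂ → V) |
          IPM G p₁ p₂ - ε <
            |edgeFreq p₁ (A m₁ m₂ S.1 S.2) - edgeFreq p₂ (A m₁ m₂ S.1 S.2)|}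

/-- The sample complexity of the class `G` at accuracy `ε` and confidence `δ`: the smallest `m`
that suffices for some rule; `⊤` if there is none. -/
def sampleComplexity {V : Type*} [MeasurableSpace V] {k : ℕ} (G : Set (Set (Fin k → V)))
    (ε δ : ℝ) : ℕ∞ :=
  ⨅ (m : ℕ) (_ : ∃ A : Algo V k, Discriminates G A ε δ m), (m : ℕ∞)

/-- The rule `A` always outputs a member of `G` at which the empirical discrepancy
`|L_{S₁}(g) - L_{S₂}(g)|` is maximal over `G`. -/
def IsEmpiricalMaximizer {V : Type*} {k : ℕ} (G : Set (Set (Fin k → V))) (A : Algo V k) : Prop :=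
  ∀ (m₁ m₂ : ℕ) (S₁ : Fin m₁ → V) (S₂ : Fin m₂ → V),
    A m₁ m₂ S₁ S₂ ∈ G ∧
      ∀ g ∈ G, |empFreq S₁ g - empFreq S₂ g| ≤
        |empFreq S₁ (A m₁ m₂ S₁ S₂) - empFreq S₂ (A m₁ m₂ S₁ S₂)|

end GraphDisc

end

namespace GraphDisc

open Finset in
theorem sum_choose_le_exp_mul_div_pow {l d : ℕ} (hd : 1 ≤ d) (hdl : d ≤ l) :
    ((∑ k ∈ Iic d, l.choose k : ℕ) : ℝ) ≤ (Real.exp 1 * l / d) ^ d := by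
  have hd0 : (0 : ℝ) < d := by exact_mod_cast hd
  have hl0 : (0 : ℝ) < l := by exact_mod_cast (lt_of_lt_of_le hd hdl)
  set t : ℝ := d / l with ht
  have ht0 : 0 < t := by positivity
  have ht1 : t ≤ 1 := by
    rw [ht, div_le_one hl0]; exact_mod_cast hdl
  have h1 : t ^ d * ((∑ k ∈ Iic d, l.choose k : ℕ) : ℝ) ≤ Real.exp d := by
    calc t ^ d * ((∑ k ∈ Iic d, l.choose k : ℕ) : ℝ)
        = ∑ k ∈ Iic d, t ^ d * (l.choose k : ℝ) := by push_cast; rw [Finset.mul_sum]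
      _ ≤ ∑ k ∈ Iic d, t ^ k * (l.choose k : ℝ) := by
          refine Finset.sum_le_sum fun k hk => ?_
          have : k ≤ d := by simpa using hk
          exact mul_le_mul_of_nonneg_right (pow_le_pow_of_le_one ht0.le ht1 this) (by positivity)
      _ ≤ ∑ k ∈ range (l + 1), t ^ k * (l.choose k : ℝ) := by
          refine Finset.sum_le_sum_of_subset_of_nonneg ?_ fun _ _ _ => by positivity
          intro k hk
          simp only [mem_Iic, mem_range] at hk ⊢
          omega
      _ = (t + 1) ^ l := by rw [add_pow]; simp
      _ ≤ (Real.exp t) ^ l := by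
          gcongr
          exact Real.add_one_le_exp t
      _ = Real.exp d := by
          rw [← Real.exp_nat_mul, ht]
          congr 1
          field_simp
  have h2 : (Real.exp 1 * l / d) ^ d = Real.exp d / t ^ d := by
    rw [← Real.exp_one_pow d, ← div_pow, ht]
    congr 1
    field_simp
  rw [h2, le_div_iff₀ (by positivity), mul_comm]
  exact h1

/-- The traces of the family `D` on the points `z i`. -/
noncomputable def traces {V Γ ι : Type*} [Fintype ι] (D : Γ → Set V) (z : ι → V) :
    Finset (Finset ι) :=
  open Classical in Finset.univ.filter fun T => ∃ a, ∀ i, i ∈ T ↔ z i ∈ D a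

theorem mem_traces {V Γ ι : Type*} [Fintype ι] {D : Γ → Set V} {z : ι → V} {T : Finset ι} :
    T ∈ traces D z ↔ ∃ a, ∀ i, i ∈ T ↔ z i ∈ D a := by
  simp [traces]

open Classical in
theorem card_le_of_shatters_traces {V Γ ι : Type*} [Fintype ι] {D : Γ → Set V} {d : ℕ}
    (hD : VCdim (Set.range D) ≤ d) {z : ι → V} {s : Finset ι} (hs : (traces D z).Shatters s) :
    s.card ≤ d := by
  have hinj : Set.InjOn z s := by
    intro i hi j hj hij
    by_contra hne
    obtain ⟨u, hu, hsu⟩ := hs (Finset.singleton_subset_iff.2 hi)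
    obtain ⟨a, ha⟩ := mem_traces.1 hu
    have h1 : i ∈ u := by
      have : i ∈ s ∩ u := by rw [hsu]; simp
      exact (Finset.mem_inter.1 this).2
    have h2 : j ∈ u := by rw [ha, ← hij, ← ha]; exact h1
    have : j ∈ s ∩ u := Finset.mem_inter.2 ⟨hj, h2⟩
    rw [hsu] at this
    exact hne (Finset.mem_singleton.1 this).symm
  have hsh : ShattersSet (Set.range D) (s.image z) := by
    intro T hT
    obtain ⟨u, hu, hsu⟩ := hs (Finset.filter_subset (fun i => z i ∈ T) s)
    obtain ⟨a, ha⟩ := mem_traces.1 hu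
    refine ⟨D a, ⟨a, rfl⟩, ?_⟩
    have key : ∀ i ∈ s, z i ∈ D a ↔ z i ∈ T := by
      intro i hi
      rw [← ha]
      have := congrArg (fun w => i ∈ w) hsu
      simpa [hi] using this
    ext x
    constructor
    · rintro ⟨hx, hxs⟩
      obtain ⟨i, hi, rfl⟩ := Finset.mem_image.1 (Finset.mem_coe.1 hxs)
      exact (key i hi).1 hx
    · intro hx
      have hxs := hT hx
      obtain ⟨i, hi, rfl⟩ := Finset.mem_image.1 (Finset.mem_coe.1 hxs)
      exact ⟨(key i hi).2 hx, hxs⟩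
  have h1 : ((s.image z).card : ℕ∞) ≤ d :=
    (le_iSup₂ (f := fun (S : Finset V) (_ : ShattersSet (Set.range D) S) => (S.card : ℕ∞))
      (s.image z) hsh).trans hD
  rw [Finset.card_image_of_injOn hinj] at h1
  exact_mod_cast h1

/-- The Sauer–Shelah bound on the number of traces. -/
theorem card_traces_le {V Γ ι : Type*} [Fintype ι] {D : Γ → Set V} {d : ℕ}
    (hD : VCdim (Set.range D) ≤ d) (z : ι → V) :
    (traces D z).card ≤ ∑ k ∈ Finset.Iic d, (Fintype.card ι).choose k := by
  classical
  refine (Finset.card_le_card_shatterer _).trans ?_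
  refine (Finset.card_shatterer_le_sum_vcDim).trans ?_
  refine Finset.sum_le_sum_of_subset (Finset.Iic_subset_Iic.2 ?_)
  refine Finset.sup_le fun s hs => ?_
  exact card_le_of_shatters_traces hD (Finset.mem_shatterer.1 hs)

/-- If the members of `B` are far apart, then few random points suffice to tell them apart. -/
theorem exists_injOn_filter {ι : Type*} [Fintype ι] [DecidableEq ι] [Nonempty ι]
    {B : Finset (Finset ι)} {y : ℝ} (hy : 0 < y)
    (hB : ∀ S ∈ B, ∀ T ∈ B, S ≠ T → (Fintype.card ι : ℝ) ≤ y * (symmDiff S T).card)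
    {l : ℕ} (hl : 2 * y * Real.log B.card < l) :
    ∃ f : Fin l → ι, Set.InjOn (fun T : Finset ι => Finset.univ.filter (f · ∈ T)) B := by
  by_contra! hcon
  set m : ℝ := (Fintype.card ι : ℝ) with hm
  have hm0 : 0 < m := by rw [hm]; exact_mod_cast Fintype.card_pos
  have hcover : (Finset.univ : Finset (Fin l → ι)) ⊆ B.offDiag.biUnion
      (fun q => Fintype.piFinset fun _ => (symmDiff q.1 q.2)ᶜ) := by
    intro f _
    have := hcon f
    simp only [Set.InjOn, not_forall] at this
    obtain ⟨S, hS, T, hT, hST, hne⟩ := this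
    simp only [Finset.mem_biUnion, Finset.mem_offDiag, Fintype.mem_piFinset, Finset.mem_compl]
    refine ⟨(S, T), ⟨hS, hT, hne⟩, fun x => ?_⟩
    have := congrArg (fun w => x ∈ w) hST
    simp only [Finset.mem_filter, Finset.mem_univ, true_and, eq_iff_iff] at this
    simp only [Finset.mem_symmDiff]
    tauto
  have h1 := (Finset.card_le_card hcover).trans Finset.card_biUnion_le
  have hbound : ∀ q ∈ B.offDiag,
      (((Fintype.piFinset fun _ : Fin l => (symmDiff q.1 q.2)ᶜ).card : ℕ) : ℝ)
        ≤ (m * Real.exp (-(1 / y))) ^ l := by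
    rintro ⟨S, T⟩ hq
    obtain ⟨hS, hT, hne⟩ := Finset.mem_offDiag.1 hq
    simp only [Fintype.card_piFinset, Finset.prod_const, Finset.card_univ, Fintype.card_fin]
    push_cast
    refine pow_le_pow_left₀ (by positivity) ?_ _
    rw [Finset.card_compl, Nat.cast_sub (Finset.card_le_univ _)]
    have h2 := hB S hS T hT hne
    have h3 : m / y ≤ (symmDiff S T).card := by
      rw [div_le_iff₀ hy]; linarith
    have h4 := Real.add_one_le_exp (-(1 / y))
    calc m - ((symmDiff S T).card : ℝ) ≤ m - m / y := by linarith
      _ = m * (-(1 / y) + 1) := by ring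
      _ ≤ m * Real.exp (-(1 / y)) := by gcongr
  have h2 : m ^ l ≤ (B.offDiag.card : ℝ) * (m * Real.exp (-(1 / y))) ^ l := by
    have h3 : ((Finset.univ : Finset (Fin l → ι)).card : ℝ) = m ^ l := by
      simp [hm]
    rw [← h3, ← nsmul_eq_mul]
    calc ((Finset.univ : Finset (Fin l → ι)).card : ℝ)
        ≤ ((∑ q ∈ B.offDiag, (Fintype.piFinset fun _ : Fin l => (symmDiff q.1 q.2)ᶜ).card : ℕ) : ℝ)
          := by exact_mod_cast h1
      _ ≤ _ := by
          push_cast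
          exact Finset.sum_le_card_nsmul _ _ _ hbound
  have hBpos : (0 : ℝ) < B.card := by
    rcases Nat.eq_zero_or_pos B.card with h | h
    · exfalso
      have : B.offDiag.card = 0 := by rw [Finset.offDiag_card, h]
      rw [this] at h2
      have : 0 < m ^ l := by positivity
      simp at h2
      linarith
    · exact_mod_cast h
  have h3 : (B.offDiag.card : ℝ) ≤ (B.card : ℝ) ^ 2 := by
    rw [Finset.offDiag_card, sq]
    exact_mod_cast Nat.sub_le _ _
  have h4 : (1 : ℝ) ≤ (B.card : ℝ) ^ 2 * Real.exp (-(1 / y)) ^ l := by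
    rw [mul_pow] at h2
    have h5 : m ^ l * 1 ≤ m ^ l * ((B.offDiag.card : ℝ) * Real.exp (-(1 / y)) ^ l) := by
      linarith
    have h6 := le_of_mul_le_mul_left h5 (by positivity)
    exact h6.trans (by gcongr)
  have h5 : (B.card : ℝ) ^ 2 * Real.exp (-(1 / y)) ^ l = Real.exp (2 * Real.log B.card - l / y) := by
    rw [← Real.exp_nat_mul, sub_eq_add_neg, Real.exp_add, two_mul, Real.exp_add,
      Real.exp_log hBpos, ← sq]
    congr 2
    ring
  rw [h5, Real.one_le_exp_iff] at h4
  have h6 : (l : ℝ) / y ≤ 2 * Real.log B.card := by linarith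
  rw [div_le_iff₀ hy] at h6
  linarith

/-- A packing bound for classes of finite VC dimension. -/
theorem log_card_le_of_separated {V Γ ι : Type*} [Fintype ι] [DecidableEq ι] [Nonempty ι]
    {D : Γ → Set V} {d : ℕ} (hd : 1 ≤ d) (hD : VCdim (Set.range D) ≤ d) {z : ι → V}
    {B : Finset (Finset ι)} (hBz : B ⊆ traces D z) {y : ℝ} (hy : 1 ≤ y)
    (hB : ∀ S ∈ B, ∀ T ∈ B, S ≠ T → (Fintype.card ι : ℝ) ≤ y * (symmDiff S T).card) :
    Real.log B.card ≤ 2 * d * Real.log (3 * Real.exp 1 * y) := by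
  have hd0 : (1 : ℝ) ≤ d := by exact_mod_cast hd
  have he := Real.exp_pos 1
  have hlog : 1 ≤ Real.log (3 * Real.exp 1 * y) := by
    rw [Real.le_log_iff_exp_le (by positivity)]
    nlinarith
  by_cases hN : Real.log B.card ≤ d
  · nlinarith
  push Not at hN
  set L := Real.log B.card with hL
  have hL1 : 1 < L := lt_of_le_of_lt hd0 hN
  set l := ⌊2 * y * L⌋₊ + 1 with hl
  have hl1 : 2 * y * L < l := by
    rw [hl]; push_cast; exact Nat.lt_floor_add_one _
  have hl2 : (l : ℝ) ≤ 3 * y * L := by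
    have : (⌊2 * y * L⌋₊ : ℝ) ≤ 2 * y * L := Nat.floor_le (by positivity)
    rw [hl]; push_cast
    nlinarith
  obtain ⟨f, hf⟩ := exists_injOn_filter (lt_of_lt_of_le one_pos hy) hB hl1
  have hcard : B.card ≤ (traces D (z ∘ f)).card := by
    refine Finset.card_le_card_of_injOn _ ?_ hf
    intro T hT
    obtain ⟨a, ha⟩ := mem_traces.1 (hBz hT)
    refine Finset.mem_coe.2 (mem_traces.2 ⟨a, fun i => ?_⟩)
    simp [ha]
  have hdl : d ≤ l := by
    have : (d : ℝ) ≤ l := by nlinarith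
    exact_mod_cast this
  have h1 : (B.card : ℝ) ≤ (Real.exp 1 * l / d) ^ d := by
    refine le_trans ?_ (sum_choose_le_exp_mul_div_pow hd hdl)
    have := hcard.trans (card_traces_le hD (z ∘ f))
    rw [Fintype.card_fin] at this
    exact_mod_cast this
  have hBpos : (0 : ℝ) < B.card := by
    rcases Nat.eq_zero_or_pos B.card with h | h
    · rw [hL, h] at hL1; simp at hL1; linarith
    · exact_mod_cast h
  have hlpos : (0 : ℝ) < l := by
    rw [hl]; positivity
  set x := L / d with hx
  have hx0 : 0 < x := by positivity
  have h2 : L ≤ d * Real.log (Real.exp 1 * l / d) := by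
    rw [← Real.log_pow]
    exact Real.log_le_log hBpos h1
  have h3 : Real.exp 1 * l / d ≤ 3 * Real.exp 1 * y * x := by
    rw [hx, div_le_iff₀ (by linarith)]
    have : 3 * Real.exp 1 * y * (L / d) * d = Real.exp 1 * (3 * y * L) := by
      field_simp
    rw [this]
    gcongr
  have h4 : Real.log (Real.exp 1 * l / d) ≤ Real.log (3 * Real.exp 1 * y) + Real.log x := by
    rw [← Real.log_mul (by positivity) (by positivity)]
    exact Real.log_le_log (by positivity) h3
  have h5 : Real.log x ≤ x / 2 := by
    have h6 : Real.log (x / 2) ≤ x / 2 - 1 := Real.log_le_sub_one_of_pos (by positivity)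
    rw [Real.log_div (by positivity) (by norm_num)] at h6
    have := Real.log_two_lt_d9
    linarith
  have h6 : L = d * x := by rw [hx]; field_simp
  have h7 : (d : ℝ) * x ≤ d * (Real.log (3 * Real.exp 1 * y) + x / 2) := by
    rw [← h6]
    refine h2.trans ?_
    gcongr
    linarith
  rw [h6]
  linarith

/-- The sign `±1` encoded by a Boolean. -/
def boolSign (b : Bool) : ℝ := if b then 1 else -1

/-- The average over all choices of signs. -/
noncomputable def signAvg {ι : Type*} [Fintype ι] [DecidableEq ι] (F : (ι → Bool) → ℝ) : ℝ :=
  (∑ σ, F σ) / 2 ^ Fintype.card ι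

section signAvg

variable {ι : Type*} [Fintype ι] [DecidableEq ι]

theorem signAvg_mono {F F' : (ι → Bool) → ℝ} (h : ∀ σ, F σ ≤ F' σ) : signAvg F ≤ signAvg F' := by
  unfold signAvg
  gcongr with σ
  exact h σ

theorem signAvg_add (F F' : (ι → Bool) → ℝ) :
    signAvg (fun σ => F σ + F' σ) = signAvg F + signAvg F' := by
  unfold signAvg
  rw [Finset.sum_add_distrib, add_div]

theorem signAvg_sum {κ : Type*} (s : Finset κ) (F : κ → (ι → Bool) → ℝ) :
    signAvg (fun σ => ∑ j ∈ s, F j σ) = ∑ j ∈ s, signAvg (F j) := by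
  unfold signAvg
  rw [Finset.sum_comm, Finset.sum_div]

theorem signAvg_const_mul (c : ℝ) (F : (ι → Bool) → ℝ) :
    signAvg (fun σ => c * F σ) = c * signAvg F := by
  unfold signAvg
  rw [← Finset.mul_sum, mul_div_assoc]

theorem signAvg_const (c : ℝ) : signAvg (fun _ : ι → Bool => c) = c := by
  simp [signAvg]

theorem signAvg_exp_le (a : ι → ℝ) :
    signAvg (fun σ => Real.exp (∑ i, boolSign (σ i) * a i)) ≤ Real.exp ((∑ i, a i ^ 2) / 2) := by
  have h1 : ∑ σ : ι → Bool, Real.exp (∑ i, boolSign (σ i) * a i)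
      = ∏ i, (Real.exp (a i) + Real.exp (-a i)) := by
    have := Finset.prod_univ_sum (fun _ : ι => (Finset.univ : Finset Bool))
      (fun i b => Real.exp (boolSign b * a i))
    rw [Fintype.piFinset_univ] at this
    simp only [Real.exp_sum]
    rw [← this]
    refine Finset.prod_congr rfl fun i _ => ?_
    simp [boolSign]
  have h2 : ∀ i, Real.exp (a i) + Real.exp (-a i) ≤ 2 * Real.exp (a i ^ 2 / 2) := by
    intro i
    have := Real.cosh_le_exp_half_sq (a i)
    rw [Real.cosh_eq] at this
    linarith
  unfold signAvg
  rw [h1, div_le_iff₀ (by positivity)]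
  calc ∏ i, (Real.exp (a i) + Real.exp (-a i))
      ≤ ∏ i, 2 * Real.exp (a i ^ 2 / 2) :=
        Finset.prod_le_prod (fun i _ => by positivity) fun i _ => h2 i
    _ = Real.exp ((∑ i, a i ^ 2) / 2) * 2 ^ Fintype.card ι := by
        rw [Finset.prod_mul_distrib, ← Real.exp_sum, Finset.sum_div]
        simp [mul_comm]

theorem exp_signAvg_le (F : (ι → Bool) → ℝ) :
    Real.exp (signAvg F) ≤ signAvg (fun σ => Real.exp (F σ)) := by
  have h := convexOn_exp.map_sum_le (t := (Finset.univ : Finset (ι → Bool)))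
    (w := fun _ => ((2 : ℝ) ^ Fintype.card ι)⁻¹) (p := F) (fun _ _ => by positivity)
    (by simp) (fun _ _ => Set.mem_univ _)
  simp only [smul_eq_mul, ← Finset.mul_sum] at h
  unfold signAvg
  rwa [div_eq_inv_mul, div_eq_inv_mul]

/-- Massart's maximal inequality. -/
theorem signAvg_le_sqrt_of_forall_exists {κ : Type*} (I : Finset κ) (a : κ → ι → ℝ) {v L : ℝ}
    (hv : 0 < v) (hL : 0 < L) (ha : ∀ q ∈ I, ∑ i, a q i ^ 2 ≤ v)
    (hI : Real.log (2 * I.card) ≤ L) (F : (ι → Bool) → ℝ)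
    (hF : ∀ σ, ∃ q ∈ I, F σ ≤ |∑ i, boolSign (σ i) * a q i|) :
    signAvg F ≤ Real.sqrt (2 * v * L) := by
  have hIpos : (0 : ℝ) < I.card := by
    obtain ⟨q, hq, -⟩ := hF (fun _ => true)
    exact_mod_cast Finset.card_pos.2 ⟨q, hq⟩
  set t : ℝ := Real.sqrt (2 * L / v) with ht
  have ht0 : 0 < t := Real.sqrt_pos.2 (by positivity)
  have ht2 : t ^ 2 = 2 * L / v := Real.sq_sqrt (by positivity)
  have key : Real.exp (t * signAvg F) ≤ Real.exp (L + t ^ 2 * v / 2) := by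
    calc Real.exp (t * signAvg F) = Real.exp (signAvg fun σ => t * F σ) := by
          rw [signAvg_const_mul]
      _ ≤ signAvg (fun σ => Real.exp (t * F σ)) := exp_signAvg_le _
      _ ≤ signAvg (fun σ => ∑ q ∈ I, (Real.exp (∑ i, boolSign (σ i) * (t * a q i))
            + Real.exp (∑ i, boolSign (σ i) * (-t * a q i)))) := by
          refine signAvg_mono fun σ => ?_
          obtain ⟨q, hq, hFq⟩ := hF σ
          refine le_trans ?_ (Finset.single_le_sum (f := fun q =>
            (Real.exp (∑ i, boolSign (σ i) * (t * a q i))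
            + Real.exp (∑ i, boolSign (σ i) * (-t * a q i)))) (fun _ _ => by positivity) hq)
          have e1 : ∑ i, boolSign (σ i) * (t * a q i) = t * ∑ i, boolSign (σ i) * a q i := by
            rw [Finset.mul_sum]; exact Finset.sum_congr rfl fun _ _ => by ring
          have e2 : ∑ i, boolSign (σ i) * (-t * a q i) = -(t * ∑ i, boolSign (σ i) * a q i) := by
            rw [Finset.mul_sum, ← Finset.sum_neg_distrib]
            exact Finset.sum_congr rfl fun _ _ => by ring
          simp only [e1, e2]
          rcases abs_cases (∑ i, boolSign (σ i) * a q i) with ⟨h, _⟩ | ⟨h, _⟩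
          · refine le_trans (Real.exp_le_exp.2 ?_) (le_add_of_nonneg_right (Real.exp_pos _).le)
            rw [h] at hFq
            gcongr
          · refine le_trans (Real.exp_le_exp.2 ?_) (le_add_of_nonneg_left (Real.exp_pos _).le)
            rw [h] at hFq
            rw [← mul_neg]
            gcongr
      _ ≤ ∑ q ∈ I, (2 * Real.exp (t ^ 2 * v / 2)) := by
          rw [signAvg_sum]
          refine Finset.sum_le_sum fun q hq => ?_
          rw [signAvg_add, two_mul]
          have hq' := ha q hq
          have e1 : ∑ i, (t * a q i) ^ 2 = t ^ 2 * ∑ i, a q i ^ 2 := by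
            rw [Finset.mul_sum]; exact Finset.sum_congr rfl fun _ _ => by ring
          have e2 : ∑ i, (-t * a q i) ^ 2 = t ^ 2 * ∑ i, a q i ^ 2 := by
            rw [Finset.mul_sum]; exact Finset.sum_congr rfl fun _ _ => by ring
          refine add_le_add ((signAvg_exp_le _).trans ?_) ((signAvg_exp_le _).trans ?_)
          · rw [e1]; gcongr
          · rw [e2]; gcongr
      _ = Real.exp (Real.log (2 * I.card)) * Real.exp (t ^ 2 * v / 2) := by
          rw [Real.exp_log (by positivity), Finset.sum_const, nsmul_eq_mul]
          ring
      _ ≤ Real.exp L * Real.exp (t ^ 2 * v / 2) := by gcongr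
      _ = Real.exp (L + t ^ 2 * v / 2) := by rw [Real.exp_add]
  rw [Real.exp_le_exp, ht2] at key
  have e3 : L + 2 * L / v * v / 2 = 2 * L := by field_simp; ring
  rw [e3] at key
  have e4 : t * Real.sqrt (2 * v * L) = 2 * L := by
    rw [ht, ← Real.sqrt_mul (by positivity)]
    have : 2 * L / v * (2 * v * L) = (2 * L) ^ 2 := by field_simp
    rw [this, Real.sqrt_sq (by positivity)]
  rw [← e4] at key
  exact le_of_mul_le_mul_left key ht0

end signAvg

section chaining

variable {ι : Type*} [Fintype ι] [DecidableEq ι]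

theorem exists_separated_net [Nonempty ι] (A : Finset (Finset ι)) (y : ℝ) :
    ∃ B ⊆ A, (∀ S ∈ B, ∀ T ∈ B, S ≠ T → (Fintype.card ι : ℝ) ≤ y * (symmDiff S T).card) ∧
      ∀ T ∈ A, ∃ S ∈ B, y * (symmDiff S T).card < (Fintype.card ι : ℝ) := by
  classical
  set P := A.powerset.filter fun B => ∀ S ∈ B, ∀ T ∈ B, S ≠ T →
    (Fintype.card ι : ℝ) ≤ y * (symmDiff S T).card with hP
  have hne : P.Nonempty := ⟨∅, by simp [hP]⟩
  obtain ⟨B, hB, hmax⟩ := P.exists_max_image Finset.card hne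
  obtain ⟨hBA, hsep⟩ := Finset.mem_filter.1 hB
  rw [Finset.mem_powerset] at hBA
  refine ⟨B, hBA, hsep, fun T hT => ?_⟩
  have hm : (0 : ℝ) < Fintype.card ι := by exact_mod_cast Fintype.card_pos
  by_cases hTB : T ∈ B
  · exact ⟨T, hTB, by simpa using hm⟩
  by_contra! hcon
  have hins : insert T B ∈ P := by
    refine Finset.mem_filter.2 ⟨Finset.mem_powerset.2 (Finset.insert_subset hT hBA), ?_⟩
    intro S hS S' hS' hne
    rcases Finset.mem_insert.1 hS with rfl | h1 <;> rcases Finset.mem_insert.1 hS' with rfl | h2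
    · exact absurd rfl hne
    · rw [symmDiff_comm]; exact hcon _ h2
    · exact hcon _ h1
    · exact hsep _ h1 _ h2 hne
  have := hmax _ hins
  rw [Finset.card_insert_of_notMem hTB] at this
  omega

theorem card_symmDiff_triangle (S T U : Finset ι) :
    (symmDiff S U).card ≤ (symmDiff S T).card + (symmDiff T U).card :=
  (Finset.card_le_card (symmDiff_triangle S T U)).trans (Finset.card_union_le _ _)

theorem sum_sq_indicator_sub (S T : Finset ι) :
    ∑ i, ((if i ∈ S then (1 : ℝ) else 0) - (if i ∈ T then 1 else 0)) ^ 2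
      = ((symmDiff S T).card : ℝ) := by
  have h : ∀ i, ((if i ∈ S then (1 : ℝ) else 0) - (if i ∈ T then 1 else 0)) ^ 2
      = if i ∈ symmDiff S T then 1 else 0 := by
    intro i
    by_cases h1 : i ∈ S <;> by_cases h2 : i ∈ T <;> simp [Finset.mem_symmDiff, h1, h2]
  simp only [h]
  simp

theorem log_three_mul_exp_mul_four_pow_le (j : ℕ) :
    Real.log (3 * Real.exp 1 * 4 ^ j) ≤ 3 * (j + 1) := by
  rw [Real.log_mul (by positivity) (by positivity), Real.log_mul (by norm_num) (by positivity),
    Real.log_exp, Real.log_pow]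
  have h1 : Real.log 3 ≤ 3 - 1 := Real.log_le_sub_one_of_pos (by norm_num)
  have h2 : Real.log 4 ≤ 4 - 1 := Real.log_le_sub_one_of_pos (by norm_num)
  have h3 : (j : ℝ) * Real.log 4 ≤ j * 3 := by gcongr; linarith
  linarith

theorem sum_add_two_div_two_pow_le (J : ℕ) :
    ∑ j ∈ Finset.range J, ((j : ℝ) + 2) / 2 ^ j ≤ 6 := by
  have h : ∑ j ∈ Finset.range J, ((j : ℝ) + 2) / 2 ^ j = 6 - (2 * J + 6) / 2 ^ J := by
    induction J with
    | zero => simp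
    | succ J ih =>
      rw [Finset.sum_range_succ, ih, pow_succ]
      push_cast
      field_simp
      ring
  rw [h]
  have : (0 : ℝ) ≤ (2 * J + 6) / 2 ^ J := by positivity
  linarith

theorem log_two_mul_card_le (n : ℕ) : Real.log (2 * n) ≤ 1 + Real.log n := by
  rcases Nat.eq_zero_or_pos n with rfl | hn
  · simp
  rw [Real.log_mul (by norm_num) (by positivity)]
  have := Real.log_le_sub_one_of_pos (show (0 : ℝ) < 2 by norm_num)
  linarith

/-- Dudley's chaining bound for the Rademacher averages of a class of finite VC dimension. -/
theorem signAvg_le_of_VCdim [Nonempty ι] {V Γ : Type*} {D : Γ → Set V} {d : ℕ} (hd : 1 ≤ d)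
    (hD : VCdim (Set.range D) ≤ d) (z : ι → V) (F : (ι → Bool) → ℝ)
    (hF : ∀ σ, ∃ a, F σ ≤ |∑ i, boolSign (σ i) * (D a).indicator (fun _ => (1 : ℝ)) (z i)|) :
    signAvg F ≤ 46 * Real.sqrt (d * Fintype.card ι) := by
  classical
  set m : ℝ := (Fintype.card ι : ℝ) with hm
  have hm0 : 0 < m := by rw [hm]; exact_mod_cast Fintype.card_pos
  have hd1 : (1 : ℝ) ≤ d := by exact_mod_cast hd
  let X : (ι → Bool) → Finset ι → ℝ := fun σ T =>
    ∑ i, boolSign (σ i) * (if i ∈ T then 1 else 0)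
  have hFA : ∀ σ, ∃ T ∈ traces D z, F σ ≤ |X σ T| := by
    intro σ
    obtain ⟨a, ha⟩ := hF σ
    refine ⟨Finset.univ.filter fun i => z i ∈ D a, mem_traces.2 ⟨a, by simp⟩, ?_⟩
    simpa only [X, Set.indicator_apply, Finset.mem_filter, Finset.mem_univ, true_and] using ha
  choose U hUA hU using hFA
  choose N hNA hNsep hNnet using fun j : ℕ => exists_separated_net (traces D z) (4 ^ j)
  choose! π hπN hπ using hNnet
  have hlogN : ∀ j, Real.log (N j).card ≤ 6 * d * (j + 1) := by
    intro j
    have h1 := log_card_le_of_separated hd hD (hNA j) (one_le_pow₀ (by norm_num)) (hNsep j)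
    have h2 := log_three_mul_exp_mul_four_pow_le j
    nlinarith
  obtain ⟨J, hJ⟩ := pow_unbounded_of_one_lt m (show (1 : ℝ) < 4 by norm_num)
  have hπJ : ∀ T ∈ traces D z, π J T = T := by
    intro T hT
    have h1 := hπ J T hT
    by_contra hne
    have h2 : 1 ≤ (symmDiff (π J T) T).card := by
      rw [Nat.one_le_iff_ne_zero, Ne, Finset.card_eq_zero]
      intro h
      exact hne (symmDiff_eq_bot.1 h)
    have h3 : (1 : ℝ) ≤ (symmDiff (π J T) T).card := by exact_mod_cast h2
    have h4 : (0 : ℝ) < 4 ^ J := by positivity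
    nlinarith
  have hchain : ∀ σ, F σ ≤ |X σ (π 0 (U σ))|
      + ∑ j ∈ Finset.range J, |X σ (π (j + 1) (U σ)) - X σ (π j (U σ))| := by
    intro σ
    refine (hU σ).trans ?_
    have h1 : X σ (U σ) = X σ (π 0 (U σ))
        + ∑ j ∈ Finset.range J, (X σ (π (j + 1) (U σ)) - X σ (π j (U σ))) := by
      rw [Finset.sum_range_sub (fun j => X σ (π j (U σ))), hπJ _ (hUA σ)]
      ring
    rw [h1]
    exact (abs_add_le _ _).trans (by gcongr; exact Finset.abs_sum_le_sum_abs _ _)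
  have hroot : signAvg (fun σ => |X σ (π 0 (U σ))|) ≤ 4 * Real.sqrt (d * m) := by
    have h1 := signAvg_le_sqrt_of_forall_exists (N 0) (fun T i => if i ∈ T then (1 : ℝ) else 0)
      (v := m) (L := 7 * d) hm0 (by positivity)
      (by
        intro T _
        have := sum_sq_indicator_sub T ∅
        simp only [Finset.notMem_empty, if_false, sub_zero] at this
        rw [this, hm]
        exact_mod_cast Finset.card_le_univ _)
      (by
        have h2 := log_two_mul_card_le (N 0).card
        have h3 := hlogN 0
        push_cast at h3
        linarith)
      (fun σ => |X σ (π 0 (U σ))|) (fun σ => ⟨π 0 (U σ), hπN 0 _ (hUA σ), le_rfl⟩)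
    refine h1.trans (Real.sqrt_le_iff.2 ⟨by positivity, ?_⟩)
    rw [mul_pow, Real.sq_sqrt (by positivity)]
    have : 0 < d * m := by positivity
    nlinarith
  have hlink : ∀ j, signAvg (fun σ => |X σ (π (j + 1) (U σ)) - X σ (π j (U σ))|)
      ≤ 7 * Real.sqrt (d * m) * (((j : ℝ) + 2) / 2 ^ j) := by
    intro j
    have h4 : (0 : ℝ) < 4 ^ j := by positivity
    set I := ((N (j + 1)) ×ˢ (N j)).filter fun q =>
      ((symmDiff q.1 q.2).card : ℝ) ≤ 2 * m / 4 ^ j with hI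
    have hIcard : Real.log (2 * I.card) ≤ 12 * d * (j + 2) := by
      rcases Nat.eq_zero_or_pos I.card with h0 | h0
      · rw [h0]; simp; positivity
      have h5 : I.card ≤ (N (j + 1)).card * (N j).card := by
        rw [← Finset.card_product]; exact Finset.card_filter_le _ _
      have h6 : 0 < (N (j + 1)).card * (N j).card := lt_of_lt_of_le h0 h5
      have h7 : (0 : ℝ) < (N (j + 1)).card := by exact_mod_cast Nat.pos_of_mul_pos_right h6
      have h8 : (0 : ℝ) < (N j).card := by exact_mod_cast Nat.pos_of_mul_pos_left h6
      have h9 : Real.log I.card ≤ Real.log ((N (j + 1)).card * (N j).card) :=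
        Real.log_le_log (by exact_mod_cast h0) (by exact_mod_cast h5)
      rw [Real.log_mul h7.ne' h8.ne'] at h9
      have h10 := log_two_mul_card_le I.card
      have h11 := hlogN j
      have h12 := hlogN (j + 1)
      push_cast at h12
      linarith
    have h1 := signAvg_le_sqrt_of_forall_exists I
      (fun q i => (if i ∈ q.1 then (1 : ℝ) else 0) - (if i ∈ q.2 then 1 else 0))
      (v := 2 * m / 4 ^ j) (L := 12 * d * (j + 2)) (by positivity) (by positivity)
      (by
        intro q hq
        rw [sum_sq_indicator_sub]
        exact (Finset.mem_filter.1 hq).2)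
      hIcard (fun σ => |X σ (π (j + 1) (U σ)) - X σ (π j (U σ))|)
      (by
        intro σ
        refine ⟨(π (j + 1) (U σ), π j (U σ)), ?_, ?_⟩
        · refine Finset.mem_filter.2 ⟨Finset.mem_product.2 ⟨hπN _ _ (hUA σ), hπN _ _ (hUA σ)⟩, ?_⟩
          have h5 := card_symmDiff_triangle (π (j + 1) (U σ)) (U σ) (π j (U σ))
          have h6 := hπ (j + 1) (U σ) (hUA σ)
          have h7 := hπ j (U σ) (hUA σ)
          rw [symmDiff_comm] at h7
          have h8 : ((symmDiff (π (j + 1) (U σ)) (π j (U σ))).card : ℝ)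
              ≤ (symmDiff (π (j + 1) (U σ)) (U σ)).card + (symmDiff (U σ) (π j (U σ))).card := by
            exact_mod_cast h5
          rw [pow_succ] at h6
          have h9 : (0 : ℝ) ≤ (symmDiff (π (j + 1) (U σ)) (U σ)).card := by positivity
          rw [le_div_iff₀ h4]
          nlinarith
        · simp only [X, mul_sub, Finset.sum_sub_distrib, le_refl])
    refine h1.trans (Real.sqrt_le_iff.2 ⟨by positivity, ?_⟩)
    have e1 : (7 * Real.sqrt (d * m) * (((j : ℝ) + 2) / 2 ^ j)) ^ 2
        = 49 * (d * m) * (j + 2) ^ 2 / 4 ^ j := by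
      rw [mul_pow, mul_pow, Real.sq_sqrt (by positivity), div_pow, ← pow_mul, mul_comm j 2, pow_mul]
      norm_num
      ring
    rw [e1]
    have e2 : 2 * (2 * m / 4 ^ j) * (12 * d * ((j : ℝ) + 2)) = 48 * (d * m) * (j + 2) / 4 ^ j := by
      ring
    rw [e2]
    gcongr ?_ / _
    have h5 : 0 < d * m := by positivity
    have h6 : (0 : ℝ) ≤ j := by positivity
    nlinarith [mul_nonneg h5.le h6, mul_nonneg h5.le (sq_nonneg (j : ℝ))]
  calc signAvg F ≤ signAvg (fun σ => |X σ (π 0 (U σ))|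
        + ∑ j ∈ Finset.range J, |X σ (π (j + 1) (U σ)) - X σ (π j (U σ))|) := signAvg_mono hchain
    _ = signAvg (fun σ => |X σ (π 0 (U σ))|)
        + ∑ j ∈ Finset.range J, signAvg (fun σ => |X σ (π (j + 1) (U σ)) - X σ (π j (U σ))|) := by
        rw [signAvg_add, signAvg_sum]
    _ ≤ 4 * Real.sqrt (d * m)
        + ∑ j ∈ Finset.range J, 7 * Real.sqrt (d * m) * (((j : ℝ) + 2) / 2 ^ j) :=
        add_le_add hroot (Finset.sum_le_sum fun j _ => hlink j)
    _ ≤ 46 * Real.sqrt (d * m) := by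
        rw [← Finset.mul_sum]
        have h1 := sum_add_two_div_two_pow_le J
        have h2 : 0 ≤ Real.sqrt (d * m) := Real.sqrt_nonneg _
        nlinarith

end chaining

theorem integrable_of_abs_le {α : Type*} [MeasurableSpace α] [DiscreteMeasurableSpace α]
    {μ : Measure α} [IsFiniteMeasure μ] {f : α → ℝ} {C : ℝ} (h : ∀ x, |f x| ≤ C) :
    Integrable f μ :=
  Integrable.of_bound (Measurable.of_discrete.aestronglyMeasurable) C
    (Filter.Eventually.of_forall h)

section suprema

variable {Γ : Type*}

theorem iSup_abs_nonneg (φ : Γ → ℝ) : 0 ≤ ⨆ a, |φ a| :=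
  Real.iSup_nonneg fun _ => abs_nonneg _

theorem bddAbove_range_abs {φ : Γ → ℝ} {C : ℝ} (h : ∀ a, |φ a| ≤ C) :
    BddAbove (Set.range fun a => |φ a|) :=
  ⟨C, by rintro _ ⟨a, rfl⟩; exact h a⟩

theorem abs_le_iSup_abs {φ : Γ → ℝ} {C : ℝ} (h : ∀ a, |φ a| ≤ C) (a : Γ) :
    |φ a| ≤ ⨆ a, |φ a| :=
  le_ciSup (bddAbove_range_abs h) a

theorem abs_iSup_abs_le [Nonempty Γ] {φ : Γ → ℝ} {C : ℝ} (h : ∀ a, |φ a| ≤ C) :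
    |(⨆ a, |φ a|)| ≤ C := by
  rw [abs_of_nonneg (iSup_abs_nonneg φ)]
  exact ciSup_le h

theorem iSup_abs_le_add [Nonempty Γ] {φ ψ : Γ → ℝ} {C c : ℝ} (hψ : ∀ a, |ψ a| ≤ C)
    (h : ∀ a, |φ a - ψ a| ≤ c) : (⨆ a, |φ a|) ≤ (⨆ a, |ψ a|) + c := by
  refine ciSup_le fun a => ?_
  have h1 := abs_le_iSup_abs hψ a
  have h2 := h a
  have h3 := abs_sub_abs_le_abs_sub (φ a) (ψ a)
  linarith

end suprema

/-- The vector that agrees with `S` where `σ` is true and with `S'` elsewhere. -/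
def mix {ι V : Type*} (σ : ι → Bool) (S S' : ι → V) : ι → V := fun i => if σ i then S i else S' i

section signs

variable {V : Type*}

theorem abs_sum_indicator_le {m : ℕ} {c : Fin m → ℝ} (hc : ∀ i, |c i| ≤ 1) (D : Set V)
    (z : Fin m → V) : |∑ i, c i * D.indicator (fun _ => (1 : ℝ)) (z i)| ≤ m := by
  refine (Finset.abs_sum_le_sum_abs _ _).trans ?_
  calc ∑ i, |c i * D.indicator (fun _ => (1 : ℝ)) (z i)| ≤ ∑ _i : Fin m, (1 : ℝ) := by
        refine Finset.sum_le_sum fun i _ => ?_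
        rw [abs_mul]
        by_cases h : z i ∈ D <;> simp [h, hc i]
    _ = m := by simp

theorem abs_boolSign (b : Bool) : |boolSign b| = 1 := by cases b <;> simp [boolSign]

/-- The Rademacher average of the class `D` on the sample `z`, for the signs `σ`. -/
noncomputable def rademacherSup {Γ : Type*} {m : ℕ} (D : Γ → Set V) (z : Fin m → V) (σ : Fin m → Bool) : ℝ :=
  ⨆ a, |∑ i, boolSign (σ i) * (D a).indicator (fun _ => (1 : ℝ)) (z i)|

theorem exists_rademacherSup_eq {Γ : Type*} [Nonempty Γ] {m : ℕ} (D : Γ → Set V) (z : Fin m → V)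
    (σ : Fin m → Bool) : ∃ a, rademacherSup D z σ
      = |∑ i, boolSign (σ i) * (D a).indicator (fun _ => (1 : ℝ)) (z i)| := by
  classical
  have hfin : (Set.range fun a =>
      |∑ i, boolSign (σ i) * (D a).indicator (fun _ => (1 : ℝ)) (z i)|).Finite := by
    refine (Set.finite_range fun T : Finset (Fin m) =>
      |∑ i, boolSign (σ i) * (if i ∈ T then (1 : ℝ) else 0)|).subset ?_
    rintro _ ⟨a, rfl⟩
    refine ⟨Finset.univ.filter fun i => z i ∈ D a, ?_⟩
    simp only [Set.indicator_apply, Finset.mem_filter, Finset.mem_univ, true_and]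
  obtain ⟨a, ha⟩ := (Set.range_nonempty _).csSup_mem hfin
  exact ⟨a, ha.symm⟩

theorem signAvg_rademacherSup_le {Γ : Type*} [Nonempty Γ] {m d : ℕ} (hm : 1 ≤ m) (hd : 1 ≤ d)
    {D : Γ → Set V} (hD : VCdim (Set.range D) ≤ d) (z : Fin m → V) :
    signAvg (rademacherSup D z) ≤ 46 * Real.sqrt (d * m) := by
  have : Nonempty (Fin m) := ⟨⟨0, hm⟩⟩
  have := signAvg_le_of_VCdim hd hD z (rademacherSup D z) fun σ => by
    obtain ⟨a, ha⟩ := exists_rademacherSup_eq D z σ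
    exact ⟨a, ha.le⟩
  simpa using this

theorem sum_indicator_div_mem_Icc {m : ℕ} (D : Set V) (S : Fin m → V) :
    (∑ j, D.indicator (fun _ => (1 : ℝ)) (S j)) / m ∈ Set.Icc (0 : ℝ) 1 := by
  have h0 : ∀ j, 0 ≤ D.indicator (fun _ => (1 : ℝ)) (S j) := fun j =>
    Set.indicator_nonneg (fun _ _ => zero_le_one) _
  refine ⟨div_nonneg (Finset.sum_nonneg fun j _ => h0 j) (by positivity),
    div_le_one_of_le₀ ?_ (by positivity)⟩
  calc _ ≤ ∑ _j : Fin m, (1 : ℝ) :=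
        Finset.sum_le_sum fun j _ => Set.indicator_le_self' (fun _ _ => zero_le_one) _
    _ = m := by simp

theorem abs_sub_le_one {x y : ℝ} (hx : x ∈ Set.Icc (0 : ℝ) 1) (hy : y ∈ Set.Icc (0 : ℝ) 1) :
    |x - y| ≤ 1 :=
  abs_le.2 ⟨by linarith [hx.1, hy.2], by linarith [hx.2, hy.1]⟩

/-- The supremum of the difference of the counts in two samples. -/
noncomputable def ghostSup {Γ : Type*} {m : ℕ} (D : Γ → Set V) (S S' : Fin m → V) : ℝ :=
  ⨆ a, |∑ j, ((D a).indicator (fun _ => (1 : ℝ)) (S' j)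
    - (D a).indicator (fun _ => (1 : ℝ)) (S j))|

theorem abs_ghostSup_term_le {m : ℕ} (D : Set V) (S S' : Fin m → V) :
    |∑ j, (D.indicator (fun _ => (1 : ℝ)) (S' j) - D.indicator (fun _ => (1 : ℝ)) (S j))| ≤ m := by
  refine (Finset.abs_sum_le_sum_abs _ _).trans ?_
  calc _ ≤ ∑ _j : Fin m, (1 : ℝ) := by
        refine Finset.sum_le_sum fun j _ => ?_
        by_cases h : S j ∈ D <;> by_cases h' : S' j ∈ D <;> simp [h, h']
    _ = m := by simp

theorem ghostSup_mix_le {Γ : Type*} [Nonempty Γ] {m : ℕ} (D : Γ → Set V) (S S' : Fin m → V)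
    (σ : Fin m → Bool) :
    ghostSup D (mix σ S S') (mix σ S' S) ≤ rademacherSup D S' σ + rademacherSup D S σ := by
  refine ciSup_le fun a => ?_
  have e : ∑ j, ((D a).indicator (fun _ => (1 : ℝ)) (mix σ S' S j)
      - (D a).indicator (fun _ => (1 : ℝ)) (mix σ S S' j))
      = ∑ j, boolSign (σ j) * (D a).indicator (fun _ => (1 : ℝ)) (S' j)
        - ∑ j, boolSign (σ j) * (D a).indicator (fun _ => (1 : ℝ)) (S j) := by
    rw [← Finset.sum_sub_distrib]
    refine Finset.sum_congr rfl fun j _ => ?_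
    by_cases h : σ j <;> simp [mix, boolSign, h]
    ring
  rw [e]
  refine (abs_sub _ _).trans (add_le_add ?_ ?_)
  · exact abs_le_iSup_abs (fun a => abs_sum_indicator_le (fun i => (abs_boolSign (σ i)).le) _ _) a
  · exact abs_le_iSup_abs (fun a => abs_sum_indicator_le (fun i => (abs_boolSign (σ i)).le) _ _) a

end signs

section setDev

variable {V : Type*} [MeasurableSpace V]

/-- The largest deviation, over the sets `D a`, between probability and frequency in `S`. -/
noncomputable def setDev {Γ : Type*} {m : ℕ} (p : Measure V) (D : Γ → Set V) (S : Fin m → V) : ℝ :=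
  ⨆ a, |p.real (D a) - (∑ j, (D a).indicator (fun _ => (1 : ℝ)) (S j)) / m|

theorem abs_setDev_term_le {m : ℕ} (p : Measure V) [IsProbabilityMeasure p] (D : Set V)
    (S : Fin m → V) :
    |p.real D - (∑ j, D.indicator (fun _ => (1 : ℝ)) (S j)) / m| ≤ 1 :=
  abs_sub_le_one ⟨measureReal_nonneg, measureReal_le_one⟩ (sum_indicator_div_mem_Icc D S)

theorem abs_setDev_le {Γ : Type*} [Nonempty Γ] {m : ℕ} (p : Measure V) [IsProbabilityMeasure p]
    (D : Γ → Set V) (S : Fin m → V) : |setDev p D S| ≤ 1 :=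
  abs_iSup_abs_le fun a => abs_setDev_term_le p (D a) S

end setDev

section symmetrization

theorem measurePreserving_mix {V : Type*} [MeasurableSpace V] {m : ℕ} (p : Measure V) [IsProbabilityMeasure p]
    (σ : Fin m → Bool) :
    MeasurePreserving (fun q : (Fin m → V) × (Fin m → V) => (mix σ q.1 q.2, mix σ q.2 q.1))
      ((Measure.pi fun _ : Fin m => p).prod (Measure.pi fun _ : Fin m => p))
      ((Measure.pi fun _ : Fin m => p).prod (Measure.pi fun _ : Fin m => p)) := by
  have h1 := measurePreserving_arrowProdEquivProdArrow V V (Fin m) (fun _ => p) (fun _ => p)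
  have h2 : MeasurePreserving
      (fun (Z : Fin m → V × V) i => if σ i then Z i else (Z i).swap)
      (Measure.pi fun _ : Fin m => p.prod p) (Measure.pi fun _ : Fin m => p.prod p) := by
    refine measurePreserving_pi (f := fun i (x : V × V) => if σ i then x else x.swap)
      (fun _ => p.prod p) (fun _ => p.prod p) fun i => ?_
    by_cases h : σ i
    · simp only [h, if_true]
      exact MeasurePreserving.id _
    · simpa [h] using Measure.measurePreserving_swap
  have h3 := (h1.comp h2).comp (h1.symm _)
  convert h3 using 1
  funext q
  ext i <;> by_cases h : σ i <;>
    simp [mix, h, MeasurableEquiv.arrowProdEquivProdArrow, Equiv.arrowProdEquivProdArrow]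

variable {V : Type*} [Countable V] [MeasurableSpace V] [MeasurableSingletonClass V]

theorem integral_mix {m : ℕ} (p : Measure V) [IsProbabilityMeasure p] (σ : Fin m → Bool)
    (F : (Fin m → V) → (Fin m → V) → ℝ) :
    ∫ q, F (mix σ q.1 q.2) (mix σ q.2 q.1)
        ∂((Measure.pi fun _ : Fin m => p).prod (Measure.pi fun _ : Fin m => p))
      = ∫ q, F q.1 q.2
        ∂((Measure.pi fun _ : Fin m => p).prod (Measure.pi fun _ : Fin m => p)) := by
  have h := measurePreserving_mix p σ
  conv_rhs => rw [← h.map_eq]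
  rw [integral_map h.measurable.aemeasurable Measurable.of_discrete.aestronglyMeasurable]

theorem integral_indicator_eval {m : ℕ} (p : Measure V) [IsProbabilityMeasure p] (D : Set V)
    (j : Fin m) :
    ∫ S, D.indicator (fun _ => (1 : ℝ)) (S j) ∂(Measure.pi fun _ : Fin m => p) = p.real D := by
  have h := measurePreserving_eval (fun _ : Fin m => p) j
  rw [← integral_indicator_one (.of_discrete : MeasurableSet D)]
  conv_rhs => rw [← h.map_eq]
  rw [integral_map h.measurable.aemeasurable Measurable.of_discrete.aestronglyMeasurable]
  rfl

theorem setDev_le_integral_ghostSup {Γ : Type*} [Nonempty Γ] {m : ℕ} (hm : 1 ≤ m) (p : Measure V)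
    [IsProbabilityMeasure p] (D : Γ → Set V) (S : Fin m → V) :
    setDev p D S ≤ (∫ S', ghostSup D S S' ∂(Measure.pi fun _ : Fin m => p)) / m := by
  have hm0 : (0 : ℝ) < m := by exact_mod_cast hm
  refine ciSup_le fun a => ?_
  have hint : ∫ S', (∑ j, ((D a).indicator (fun _ => (1 : ℝ)) (S' j)
      - (D a).indicator (fun _ => (1 : ℝ)) (S j))) ∂(Measure.pi fun _ : Fin m => p)
      = m * p.real (D a) - ∑ j, (D a).indicator (fun _ => (1 : ℝ)) (S j) := by
    have hi : ∀ j : Fin m, Integrable (fun S' : Fin m → V =>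
        (D a).indicator (fun _ => (1 : ℝ)) (S' j)) (Measure.pi fun _ : Fin m => p) := fun j =>
      integrable_of_abs_le (C := 1) fun S' => by by_cases h : S' j ∈ D a <;> simp [h]
    rw [integral_finsetSum _ fun j _ => by exact (hi j).sub (integrable_const _)]
    simp_rw [integral_sub (hi _) (integrable_const _), integral_indicator_eval]
    simp
  have e : p.real (D a) - (∑ j, (D a).indicator (fun _ => (1 : ℝ)) (S j)) / m
      = (m * p.real (D a) - ∑ j, (D a).indicator (fun _ => (1 : ℝ)) (S j)) / m := by
    field_simp
  rw [e, ← hint, abs_div, abs_of_pos hm0]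
  gcongr
  refine abs_integral_le_integral_abs.trans (integral_mono ?_ ?_ fun S' => ?_)
  · exact integrable_of_abs_le (C := m) fun S' => by
      rw [abs_abs]; exact abs_ghostSup_term_le (D a) S S'
  · exact integrable_of_abs_le (C := m) fun S' =>
      abs_iSup_abs_le fun a => abs_ghostSup_term_le (D a) S S'
  · exact abs_le_iSup_abs (fun a => abs_ghostSup_term_le (D a) S S') a

/-- The expected uniform deviation of a class of finite VC dimension is `O(√(d / m))`. -/
theorem integral_setDev_le {Γ : Type*} [Nonempty Γ] {m d : ℕ} (hm : 1 ≤ m) (hd : 1 ≤ d)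
    (p : Measure V) [IsProbabilityMeasure p] {D : Γ → Set V} (hD : VCdim (Set.range D) ≤ d) :
    ∫ S, setDev p D S ∂(Measure.pi fun _ : Fin m => p) ≤ 92 * Real.sqrt (d / m) := by
  have hm0 : (0 : ℝ) < m := by exact_mod_cast hm
  set P := Measure.pi fun _ : Fin m => p with hP
  have hR : ∀ q : (Fin m → V) × (Fin m → V), |ghostSup D q.1 q.2| ≤ m := fun q =>
    abs_iSup_abs_le fun a => abs_ghostSup_term_le (D a) _ _
  have hRi : Integrable (fun q : (Fin m → V) × (Fin m → V) => ghostSup D q.1 q.2) (P.prod P) :=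
    integrable_of_abs_le hR
  have h1 : ∫ S, setDev p D S ∂P ≤ (∫ q, ghostSup D q.1 q.2 ∂(P.prod P)) / m := by
    rw [integral_prod _ hRi, ← integral_div]
    refine integral_mono (integrable_of_abs_le fun S => abs_setDev_le p D S)
      (hRi.integral_prod_left.div_const _) fun S => setDev_le_integral_ghostSup hm p D S
  have h2 : ∫ q, ghostSup D q.1 q.2 ∂(P.prod P) ≤ 92 * Real.sqrt (d * m) := by
    calc ∫ q, ghostSup D q.1 q.2 ∂(P.prod P)
        = signAvg (fun σ : Fin m → Bool =>
            ∫ q, ghostSup D (mix σ q.1 q.2) (mix σ q.2 q.1) ∂(P.prod P)) := by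
          simp_rw [hP, integral_mix p _ (ghostSup D)]
          rw [signAvg_const]
      _ = ∫ q, signAvg (fun σ : Fin m → Bool =>
            ghostSup D (mix σ q.1 q.2) (mix σ q.2 q.1)) ∂(P.prod P) := by
          unfold signAvg
          rw [integral_div, integral_finsetSum]
          exact fun σ _ => integrable_of_abs_le fun q => hR (mix σ q.1 q.2, mix σ q.2 q.1)
      _ ≤ ∫ _q, 92 * Real.sqrt (d * m) ∂(P.prod P) := by
          have hb : ∀ q : (Fin m → V) × (Fin m → V), signAvg (fun σ : Fin m → Bool =>
              ghostSup D (mix σ q.1 q.2) (mix σ q.2 q.1)) ≤ 92 * Real.sqrt (d * m) := by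
            intro q
            refine (signAvg_mono (ghostSup_mix_le D q.1 q.2)).trans ?_
            rw [signAvg_add]
            have h3 := signAvg_rademacherSup_le hm hd hD q.1
            have h4 := signAvg_rademacherSup_le hm hd hD q.2
            have h5 : signAvg (fun σ => rademacherSup D q.1 σ) = signAvg (rademacherSup D q.1) :=
              rfl
            have h6 : signAvg (fun σ => rademacherSup D q.2 σ) = signAvg (rademacherSup D q.2) :=
              rfl
            linarith
          refine integral_mono_of_nonneg (Filter.Eventually.of_forall fun q => ?_)
            (integrable_const _) (Filter.Eventually.of_forall hb)
          exact div_nonneg (Finset.sum_nonneg fun σ _ => iSup_abs_nonneg _) (by positivity)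
      _ = 92 * Real.sqrt (d * m) := by simp
  refine h1.trans ?_
  rw [div_le_iff₀ hm0]
  refine h2.trans (le_of_eq ?_)
  have : (d : ℝ) * m = d / m * m ^ 2 := by field_simp
  rw [this, Real.sqrt_mul (by positivity), Real.sqrt_sq hm0.le, mul_assoc]

end symmetrization

section frequencies

variable {V : Type*}

theorem empFreq_mem_Icc {k m : ℕ} (S : Fin m → V) (g : Set (Fin k → V)) :
    empFreq S g ∈ Set.Icc (0 : ℝ) 1 := by
  refine ⟨div_nonneg (Finset.sum_nonneg fun i _ =>
    Set.indicator_nonneg (fun _ _ => zero_le_one) _) (by positivity),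
    div_le_one_of_le₀ ?_ (by positivity)⟩
  calc _ ≤ ∑ _i : Fin k → Fin m, (1 : ℝ) :=
        Finset.sum_le_sum fun j _ => Set.indicator_le_self' (fun _ _ => zero_le_one) _
    _ = (m : ℝ) ^ k := by simp

theorem edgeFreq_mem_Icc [MeasurableSpace V] {k : ℕ} (p : Measure V) [IsProbabilityMeasure p]
    (g : Set (Fin k → V)) : edgeFreq p g ∈ Set.Icc (0 : ℝ) 1 :=
  ⟨measureReal_nonneg, measureReal_le_one⟩

theorem empFreq_eq_sum_fixFirst {k m : ℕ} (S : Fin m → V) (g : Set (Fin (k + 1) → V)) :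
    empFreq S g = (∑ i : Fin k → Fin m, (∑ j, {x | (Fin.cons x fun l => S (i l) :
      Fin (k + 1) → V) ∈ g}.indicator (fun _ => (1 : ℝ)) (S j)) / m) / (m : ℝ) ^ k := by
  unfold empFreq
  rw [← Finset.sum_div, div_div, ← pow_succ', Finset.sum_comm]
  congr 1
  rw [← (Fin.consEquiv fun _ => Fin m).sum_comp, Fintype.sum_prod_type]
  refine Finset.sum_congr rfl fun j _ => Finset.sum_congr rfl fun i _ => ?_
  have h : (fun l => S ((Fin.consEquiv fun _ => Fin m) (j, i) l))
      = (Fin.cons (S j) fun l => S (i l) : Fin (k + 1) → V) := by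
    funext l
    refine Fin.cases ?_ (fun l => ?_) l <;> simp [Fin.consEquiv]
  rw [h]
  by_cases hg : (Fin.cons (S j) fun l => S (i l) : Fin (k + 1) → V) ∈ g <;> simp [hg]

/-- The largest deviation, over the hypergraphs `g a`, between the edge frequency with respect to
`p` and that in the sample `S`. -/
noncomputable def freqDev {Γ : Type*} [MeasurableSpace V] {k m : ℕ} (p : Measure V)
    (g : Γ → Set (Fin k → V)) (S : Fin m → V) : ℝ :=
  ⨆ a, |edgeFreq p (g a) - empFreq S (g a)|

theorem abs_freqDev_term_le [MeasurableSpace V] {k m : ℕ} (p : Measure V)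
    [IsProbabilityMeasure p] (g : Set (Fin k → V)) (S : Fin m → V) :
    |edgeFreq p g - empFreq S g| ≤ 1 :=
  abs_sub_le_one (edgeFreq_mem_Icc p g) (empFreq_mem_Icc S g)

theorem abs_freqDev_le {Γ : Type*} [Nonempty Γ] [MeasurableSpace V] {k m : ℕ} (p : Measure V)
    [IsProbabilityMeasure p] (g : Γ → Set (Fin k → V)) (S : Fin m → V) : |freqDev p g S| ≤ 1 :=
  abs_iSup_abs_le fun a => abs_freqDev_term_le p (g a) S

/-- All the families of subsets of `V` obtained from the hypergraphs `g a` by fixing all entries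
of the tuples but one have VC dimension at most `d`. -/
def SectionsVCLE {Γ : Type*} {k : ℕ} (g : Γ → Set (Fin k → V)) (d : ℕ) : Prop :=
  ∀ (j : Fin k) (w : Fin k → V),
    VCdim (Set.range fun a => {x | Function.update w j x ∈ g a}) ≤ d

theorem SectionsVCLE.fixFirst {Γ : Type*} {k d : ℕ} {g : Γ → Set (Fin (k + 1) → V)}
    (h : SectionsVCLE g d) (v : V) : SectionsVCLE (fun a => fixFirst v (g a)) d := by
  intro j w
  have := h j.succ (Fin.cons v w)
  simpa only [GraphDisc.fixFirst, Set.mem_ofPred_eq, Fin.cons_update] using this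

theorem SectionsVCLE.cons {Γ : Type*} {k d : ℕ} {g : Γ → Set (Fin (k + 1) → V)}
    (h : SectionsVCLE g d) (u : Fin k → V) :
    VCdim (Set.range fun a => {x | (Fin.cons x u : Fin (k + 1) → V) ∈ g a}) ≤ d := by
  by_cases hV : Nonempty V
  · obtain ⟨v⟩ := hV
    have := h 0 (Fin.cons v u)
    simpa only [Fin.update_cons_zero] using this
  · rw [not_nonempty_iff] at hV
    refine iSup₂_le fun S _ => ?_
    simp [Finset.eq_empty_of_isEmpty S]

theorem setDev_le_add_of_eq_off [MeasurableSpace V] {Γ : Type*} [Nonempty Γ] {m : ℕ} (p : Measure V)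
    [IsProbabilityMeasure p] (D : Γ → Set V) {S T : Fin m → V} (I : Finset (Fin m))
    (h : ∀ j ∉ I, S j = T j) : setDev p D S ≤ setDev p D T + I.card / m := by
  refine iSup_abs_le_add (fun a => abs_setDev_term_le p (D a) T) fun a => ?_
  rw [sub_sub_sub_cancel_left, ← sub_div, ← Finset.sum_sub_distrib, abs_div,
    abs_of_nonneg (show (0 : ℝ) ≤ m by positivity)]
  gcongr
  rw [← Finset.sum_subset (Finset.subset_univ I)
    (fun j _ hj => by rw [h j hj, sub_self])]
  refine (Finset.abs_sum_le_sum_abs _ _).trans ?_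
  rw [← nsmul_one, ← Finset.sum_const]
  refine Finset.sum_le_sum fun j _ => ?_
  by_cases h1 : S j ∈ D a <;> by_cases h2 : T j ∈ D a <;> simp [h1, h2]

end frequencies

section deviation

variable {V : Type*} [Countable V] [MeasurableSpace V] [MeasurableSingletonClass V]

theorem edgeFreq_eq_integral_fixFirst {k : ℕ} (p : Measure V) [IsProbabilityMeasure p]
    (g : Set (Fin (k + 1) → V)) : edgeFreq p g = ∫ v, edgeFreq p (fixFirst v g) ∂p := by
  have h := (measurePreserving_piFinSuccAbove (fun _ : Fin (k + 1) => p) 0).symm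
  unfold edgeFreq
  rw [← h.measureReal_preimage (MeasurableSet.of_discrete.nullMeasurableSet),
    measureReal_def, Measure.prod_apply .of_discrete,
    ← integral_toReal Measurable.of_discrete.aemeasurable
      (Filter.Eventually.of_forall fun _ => measure_lt_top _ _)]
  refine integral_congr_ae (Filter.Eventually.of_forall fun v => ?_)
  have e : Prod.mk v ⁻¹' ((MeasurableEquiv.piFinSuccAbove (fun _ : Fin (k + 1) => V) 0).symm ⁻¹' g)
      = fixFirst v g := by
    ext u
    simp [fixFirst, MeasurableEquiv.piFinSuccAbove, Fin.consEquiv]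
  simp only [e, measureReal_def]

theorem integral_empFreq_fixFirst {k m : ℕ} (p : Measure V) [IsProbabilityMeasure p]
    (S : Fin m → V) (g : Set (Fin (k + 1) → V)) :
    ∫ v, empFreq S (fixFirst v g) ∂p = (∑ i : Fin k → Fin m,
      p.real {x | (Fin.cons x fun l => S (i l) : Fin (k + 1) → V) ∈ g}) / (m : ℝ) ^ k := by
  unfold empFreq
  rw [integral_div, integral_finsetSum]
  · congr 1
    refine Finset.sum_congr rfl fun i _ => ?_
    rw [← integral_indicator_one .of_discrete]
    rfl
  · intro i _
    refine integrable_of_abs_le (C := 1) fun v => ?_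
    by_cases h : (fun l => S (i l)) ∈ fixFirst v g <;> simp [h]

theorem freqDev_succ_le {Γ : Type*} [Nonempty Γ] {k m : ℕ} (p : Measure V)
    [IsProbabilityMeasure p] (g : Γ → Set (Fin (k + 1) → V)) (S : Fin m → V) :
    freqDev p g S ≤ ∫ v, freqDev p (fun a => fixFirst v (g a)) S ∂p
      + (∑ i : Fin k → Fin m, setDev p (fun a => {x | (Fin.cons x fun l => S (i l) :
          Fin (k + 1) → V) ∈ g a}) S) / (m : ℝ) ^ k := by
  refine ciSup_le fun a => ?_
  have e : edgeFreq p (g a) - empFreq S (g a)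
      = ∫ v, (edgeFreq p (fixFirst v (g a)) - empFreq S (fixFirst v (g a))) ∂p
      + (∑ i : Fin k → Fin m, (p.real {x | (Fin.cons x fun l => S (i l) :
          Fin (k + 1) → V) ∈ g a} - (∑ j, {x | (Fin.cons x fun l => S (i l) :
      Fin (k + 1) → V) ∈ g a}.indicator (fun _ => (1 : ℝ)) (S j)) / m)) / (m : ℝ) ^ k := by
    rw [integral_sub, Finset.sum_sub_distrib, sub_div, ← edgeFreq_eq_integral_fixFirst,
      integral_empFreq_fixFirst, ← empFreq_eq_sum_fixFirst]
    · ring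
    · exact integrable_of_abs_le (C := 1) fun v => by
        have := edgeFreq_mem_Icc p (fixFirst v (g a))
        rw [abs_of_nonneg this.1]; exact this.2
    · exact integrable_of_abs_le (C := 1) fun v => by
        have := empFreq_mem_Icc S (fixFirst v (g a))
        rw [abs_of_nonneg this.1]; exact this.2
  rw [e]
  refine (abs_add_le _ _).trans (add_le_add ?_ ?_)
  · refine abs_integral_le_integral_abs.trans (integral_mono ?_ ?_ fun v => ?_)
    · exact integrable_of_abs_le (C := 1) fun v => by
        rw [abs_abs]; exact abs_freqDev_term_le p _ S
    · exact integrable_of_abs_le (C := 1) fun v => abs_freqDev_le p _ S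
    · exact abs_le_iSup_abs (fun a => abs_freqDev_term_le p (fixFirst v (g a)) S) a
  · rw [abs_div, abs_of_nonneg (show (0 : ℝ) ≤ (m : ℝ) ^ k by positivity)]
    gcongr
    refine (Finset.abs_sum_le_sum_abs _ _).trans (Finset.sum_le_sum fun i _ => ?_)
    exact abs_le_iSup_abs (fun a => abs_setDev_term_le p {x | (Fin.cons x fun l => S (i l) :
          Fin (k + 1) → V) ∈ g a} S) a

/-- The deviation for a family of sets that depends on few of the sample points: these can be
replaced by independent copies. -/
theorem integral_setDev_comp_le {Γ : Type*} [Nonempty Γ] {k m d : ℕ} (hm : 1 ≤ m) (hd : 1 ≤ d)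
    (p : Measure V) [IsProbabilityMeasure p] (D : (Fin k → V) → Γ → Set V)
    (hD : ∀ u, VCdim (Set.range (D u)) ≤ d) (i : Fin k → Fin m) :
    ∫ S, setDev p (D fun l => S (i l)) S ∂(Measure.pi fun _ : Fin m => p)
      ≤ 92 * Real.sqrt (d / m) + k / m := by
  classical
  set P := Measure.pi fun _ : Fin m => p with hP
  set I : Finset (Fin m) := Finset.univ.image i with hI
  have hIk : I.card ≤ k := by
    have := Finset.card_image_le (s := Finset.univ) (f := i)
    simpa using this
  set σ : Fin m → Bool := fun j => decide (j ∉ I) with hσ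
  have hbd : ∀ (u : Fin k → V) (S : Fin m → V), |setDev p (D u) S| ≤ 1 := fun u S =>
    abs_setDev_le p _ S
  have hstep : ∀ q : (Fin m → V) × (Fin m → V), setDev p (D fun l => q.1 (i l)) q.1
      ≤ setDev p (D fun l => mix σ q.2 q.1 (i l)) (mix σ q.1 q.2) + k / m := by
    intro q
    have e : (fun l => mix σ q.2 q.1 (i l)) = fun l => q.1 (i l) := by
      funext l
      have : i l ∈ I := Finset.mem_image_of_mem _ (Finset.mem_univ l)
      simp [mix, hσ, this]
    rw [e]
    refine (setDev_le_add_of_eq_off p _ I (T := mix σ q.1 q.2) fun j hj => ?_).trans ?_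
    · simp [mix, hσ, hj]
    · gcongr
  calc ∫ S, setDev p (D fun l => S (i l)) S ∂P
      = ∫ q, setDev p (D fun l => q.1 (i l)) q.1 ∂(P.prod P) := by
        rw [integral_fun_fst (fun S => setDev p (D fun l => S (i l)) S)]
        simp
    _ ≤ ∫ q, (setDev p (D fun l => mix σ q.2 q.1 (i l)) (mix σ q.1 q.2) + k / m) ∂(P.prod P) := by
        refine integral_mono (integrable_of_abs_le fun q => hbd _ _)
          (Integrable.add (integrable_of_abs_le fun q => hbd _ _) (integrable_const _)) hstep
    _ = ∫ q, setDev p (D fun l => q.2 (i l)) q.1 ∂(P.prod P) + k / m := by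
        rw [integral_add (integrable_of_abs_le fun q => hbd _ _) (integrable_const _)]
        have := integral_mix p σ (fun S S' => setDev p (D fun l => S' (i l)) S)
        rw [← hP] at this
        rw [this]
        simp
    _ ≤ 92 * Real.sqrt (d / m) + k / m := by
        rw [integral_prod_symm _ (integrable_of_abs_le fun q => hbd _ _)]
        gcongr
        calc _ ≤ ∫ _S' : Fin m → V, 92 * Real.sqrt (d / m) ∂P :=
              integral_mono_of_nonneg (Filter.Eventually.of_forall fun S' =>
                integral_nonneg fun S => iSup_abs_nonneg _) (integrable_const _)
                (Filter.Eventually.of_forall fun S' =>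
                  integral_setDev_le hm hd p (hD fun l => S' (i l)))
          _ = 92 * Real.sqrt (d / m) := by simp

/-- The expected uniform deviation of the edge frequencies. -/
theorem integral_freqDev_le {Γ : Type*} [Nonempty Γ] {m d : ℕ} (hm : 1 ≤ m) (hd : 1 ≤ d)
    (p : Measure V) [IsProbabilityMeasure p] :
    ∀ {k : ℕ} (g : Γ → Set (Fin k → V)), SectionsVCLE g d →
      ∫ S, freqDev p g S ∂(Measure.pi fun _ : Fin m => p)
        ≤ k * (92 * Real.sqrt (d / m) + k / m)
  | 0, g, _ => by
    have h : ∀ S : Fin m → V, freqDev p g S = 0 := by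
      intro S
      unfold freqDev
      have : ∀ a, edgeFreq p (g a) - empFreq S (g a) = 0 := by
        intro a
        by_cases ha : (default : Fin 0 → V) ∈ g a
        · have : g a = Set.univ := Set.eq_univ_of_forall fun x => by
            rwa [Subsingleton.elim x default]
          simp [edgeFreq, empFreq, this]
        · have : g a = ∅ := Set.eq_empty_of_forall_notMem fun x => by
            rwa [Subsingleton.elim x default]
          simp [edgeFreq, empFreq, this]
      simp [this]
    simp [h]
  | k + 1, g, hg => by
    set P := Measure.pi fun _ : Fin m => p with hP
    have hm0 : (0 : ℝ) < m := by exact_mod_cast hm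
    set B : ℝ := 92 * Real.sqrt (d / m) + k / m with hB
    let D : (Fin k → V) → Γ → Set V := fun u a => {x | (Fin.cons x u : Fin (k + 1) → V) ∈ g a}
    have hi1 : Integrable (fun q : (Fin m → V) × V =>
        freqDev p (fun a => fixFirst q.2 (g a)) q.1) (P.prod p) :=
      integrable_of_abs_le fun q => abs_freqDev_le p _ _
    have hi2 : ∀ i : Fin k → Fin m, Integrable (fun S : Fin m → V =>
        setDev p (D fun l => S (i l)) S) P := fun i =>
      integrable_of_abs_le fun S => abs_setDev_le p _ _
    have h1 : ∫ S, ∫ v, freqDev p (fun a => fixFirst v (g a)) S ∂p ∂P ≤ k * B := by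
      rw [integral_integral_swap hi1]
      calc _ ≤ ∫ _v : V, k * B ∂p :=
            integral_mono_of_nonneg (Filter.Eventually.of_forall fun v =>
              integral_nonneg fun S => iSup_abs_nonneg _) (integrable_const _)
              (Filter.Eventually.of_forall fun v =>
                integral_freqDev_le hm hd p _ (hg.fixFirst v))
        _ = k * B := by simp
    have h2 : ∫ S, (∑ i : Fin k → Fin m, setDev p (D fun l => S (i l)) S) / (m : ℝ) ^ k ∂P
        ≤ B := by
      rw [integral_div, integral_finsetSum _ fun i _ => hi2 i, div_le_iff₀ (by positivity)]
      calc _ ≤ ∑ _i : Fin k → Fin m, B :=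
            Finset.sum_le_sum fun i _ => integral_setDev_comp_le hm hd p D hg.cons i
        _ = B * (m : ℝ) ^ k := by simp [mul_comm]
    calc ∫ S, freqDev p g S ∂P
        ≤ ∫ S, (∫ v, freqDev p (fun a => fixFirst v (g a)) S ∂p
          + (∑ i : Fin k → Fin m, setDev p (D fun l => S (i l)) S) / (m : ℝ) ^ k) ∂P := by
          refine integral_mono (integrable_of_abs_le fun S => abs_freqDev_le p g S)
            (hi1.integral_prod_left.add ((integrable_finsetSum _ fun i _ => hi2 i).div_const _))
            fun S => freqDev_succ_le p g S
      _ ≤ k * B + B := by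
          rw [integral_add hi1.integral_prod_left
            ((integrable_finsetSum _ fun i _ => hi2 i).div_const _)]
          exact add_le_add h1 h2
      _ ≤ ((k + 1 : ℕ) : ℝ) * (92 * Real.sqrt (d / m) + ((k + 1 : ℕ) : ℝ) / m) := by
          have h3 : B ≤ 92 * Real.sqrt (d / m) + ((k + 1 : ℕ) : ℝ) / m := by
            rw [hB]
            gcongr
            omega
          have h4 : (k : ℝ) * B + B = ((k + 1 : ℕ) : ℝ) * B := by push_cast; ring
          rw [h4]
          gcongr

end deviation

section boundedDifferences

variable {V : Type*} [Countable V] [MeasurableSpace V] [MeasurableSingletonClass V]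

theorem integral_pi_succ {m : ℕ} (p : Measure V) [IsProbabilityMeasure p]
    {F : (Fin (m + 1) → V) → ℝ} {C : ℝ} (hF : ∀ S, |F S| ≤ C) :
    ∫ S, F S ∂(Measure.pi fun _ : Fin (m + 1) => p)
      = ∫ x, ∫ S, F (Fin.cons x S) ∂(Measure.pi fun _ : Fin m => p) ∂p := by
  have h := (measurePreserving_piFinSuccAbove (fun _ : Fin (m + 1) => p) 0).symm
  conv_lhs => rw [← h.map_eq]
  rw [integral_map h.measurable.aemeasurable Measurable.of_discrete.aestronglyMeasurable,
    integral_prod _ (integrable_of_abs_le fun q => hF _)]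
  refine integral_congr_ae (Filter.Eventually.of_forall fun x => ?_)
  refine integral_congr_ae (Filter.Eventually.of_forall fun S => ?_)
  simp [MeasurableEquiv.piFinSuccAbove, Fin.consEquiv]

theorem integral_exp_mul_le_of_abs_sub_le (p : Measure V) [IsProbabilityMeasure p] {h : V → ℝ}
    {c : ℝ} (hc : ∀ x y, |h x - h y| ≤ c) (t : ℝ) :
    ∫ x, Real.exp (t * h x) ∂p ≤ Real.exp (t * ∫ x, h x ∂p + c ^ 2 * t ^ 2 / 2) := by
  have hne : Nonempty V := p.nonempty_of_neZero
  obtain ⟨x₀⟩ := hne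
  have hc0 : 0 ≤ c := (abs_nonneg _).trans (hc x₀ x₀)
  have h1 := ProbabilityTheory.hasSubgaussianMGF_of_mem_Icc (μ := p) (X := h) (a := h x₀ - c)
    (b := h x₀ + c) Measurable.of_discrete.aemeasurable
    (Filter.Eventually.of_forall fun x => by
      have := abs_le.1 (hc x x₀)
      exact ⟨by linarith, by linarith⟩)
  have h2 := h1.mgf_le t
  have e1 : ((((‖h x₀ + c - (h x₀ - c)‖₊ / 2) ^ 2 : NNReal) : ℝ)) = c ^ 2 := by
    push_cast
    rw [show h x₀ + c - (h x₀ - c) = 2 * c by ring, Real.norm_eq_abs, abs_of_nonneg (by positivity)]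
    ring
  rw [e1] at h2
  unfold ProbabilityTheory.mgf at h2
  have e2 : ∀ x, Real.exp (t * h x)
      = Real.exp (t * ∫ x, h x ∂p) * Real.exp (t * (h x - ∫ x, h x ∂p)) := by
    intro x
    rw [← Real.exp_add]
    congr 1
    ring
  simp_rw [e2]
  rw [integral_const_mul, Real.exp_add]
  gcongr

/-- The exponential moment bound behind McDiarmid's inequality. -/
theorem integral_exp_mul_le_of_bounded_differences (p : Measure V) [IsProbabilityMeasure p]
    (c t : ℝ) : ∀ {m : ℕ} (f : (Fin m → V) → ℝ) (C : ℝ), (∀ S, |f S| ≤ C) →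
      (∀ S j x, |f S - f (Function.update S j x)| ≤ c) →
      ∫ S, Real.exp (t * f S) ∂(Measure.pi fun _ : Fin m => p)
        ≤ Real.exp (t * ∫ S, f S ∂(Measure.pi fun _ : Fin m => p) + m * (c ^ 2 * t ^ 2 / 2))
  | 0, f, C, _, _ => by
    have h : ∀ S : Fin 0 → V, f S = f Fin.elim0 := fun S => by
      rw [Subsingleton.elim S Fin.elim0]
    simp_rw [h]
    simp
  | m + 1, f, C, hC, hc => by
    set P := Measure.pi fun _ : Fin m => p with hP
    let h : V → ℝ := fun x => ∫ S, f (Fin.cons x S) ∂P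
    have hfi : ∀ x, Integrable (fun S : Fin m → V => f (Fin.cons x S)) P := fun x =>
      integrable_of_abs_le fun S => hC _
    have hexp : ∀ S, |Real.exp (t * f S)| ≤ Real.exp (|t| * C) := by
      intro S
      rw [Real.abs_exp, Real.exp_le_exp]
      refine (le_abs_self _).trans ?_
      rw [abs_mul]
      gcongr
      exact hC S
    have hh : ∀ x y, |h x - h y| ≤ c := by
      intro x y
      simp only [h]
      rw [← integral_sub (hfi x) (hfi y)]
      have h2 : ∀ S : Fin m → V, |f (Fin.cons x S) - f (Fin.cons y S)| ≤ c := fun S => by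
        have := hc (Fin.cons x S) 0 y
        rwa [Fin.update_cons_zero] at this
      refine (abs_integral_le_integral_abs).trans ?_
      calc _ ≤ ∫ _S : Fin m → V, c ∂P := by
            refine integral_mono (integrable_of_abs_le (C := c) fun S => ?_)
              (integrable_const _) h2
            rw [abs_abs]; exact h2 S
        _ = c := by simp
    have hhC : ∀ x, |h x| ≤ C := fun x => by
      refine (abs_integral_le_integral_abs).trans ?_
      calc _ ≤ ∫ _S : Fin m → V, C ∂P :=
            integral_mono (hfi x).abs (integrable_const _) fun S => hC _
        _ = C := by simp
    rw [integral_pi_succ p hexp, integral_pi_succ p hC]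
    calc ∫ x, ∫ S, Real.exp (t * f (Fin.cons x S)) ∂P ∂p
        ≤ ∫ x, Real.exp (m * (c ^ 2 * t ^ 2 / 2)) * Real.exp (t * h x) ∂p := by
          have hi : Integrable (fun x => Real.exp (t * h x)) p :=
            integrable_of_abs_le (C := Real.exp (|t| * C)) fun x => by
              rw [Real.abs_exp, Real.exp_le_exp]
              refine (le_abs_self _).trans ?_
              rw [abs_mul]
              gcongr
              exact hhC x
          refine integral_mono_of_nonneg (Filter.Eventually.of_forall fun x =>
            integral_nonneg fun S => (Real.exp_pos _).le) (hi.const_mul _)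
            (Filter.Eventually.of_forall fun x => ?_)
          have := integral_exp_mul_le_of_bounded_differences p c t
            (fun S : Fin m → V => f (Fin.cons x S)) C (fun S => hC _) (fun S j y => by
              have := hc (Fin.cons x S) j.succ y
              rwa [← Fin.cons_update] at this)
          rw [Real.exp_add, mul_comm] at this
          exact this
      _ ≤ Real.exp (m * (c ^ 2 * t ^ 2 / 2))
          * Real.exp (t * ∫ x, h x ∂p + c ^ 2 * t ^ 2 / 2) := by
          rw [integral_const_mul]
          gcongr
          exact integral_exp_mul_le_of_abs_sub_le p hh t
      _ = Real.exp (t * ∫ x, h x ∂p + ((m + 1 : ℕ) : ℝ) * (c ^ 2 * t ^ 2 / 2)) := by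
          rw [← Real.exp_add]
          congr 1
          push_cast
          ring

/-- **McDiarmid's inequality**, with a non-optimal constant. -/
theorem measureReal_ge_le_of_bounded_differences {m : ℕ} (hm : 1 ≤ m) (p : Measure V)
    [IsProbabilityMeasure p] {f : (Fin m → V) → ℝ} {C c s : ℝ} (hC : ∀ S, |f S| ≤ C)
    (hc0 : 0 < c) (hs : 0 < s) (hc : ∀ S j x, |f S - f (Function.update S j x)| ≤ c) :
    (Measure.pi fun _ : Fin m => p).real
        {S | ∫ S, f S ∂(Measure.pi fun _ : Fin m => p) + s ≤ f S}
      ≤ Real.exp (-(s ^ 2 / (2 * (m * c ^ 2)))) := by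
  set P := Measure.pi fun _ : Fin m => p with hP
  have hm0 : (0 : ℝ) < m := by exact_mod_cast hm
  set t : ℝ := s / (m * c ^ 2) with ht
  have ht0 : 0 < t := by positivity
  set E := ∫ S, f S ∂P with hE
  have hint : Integrable (fun S => Real.exp (t * f S)) P :=
    integrable_of_abs_le (C := Real.exp (t * C)) fun S => by
      rw [Real.abs_exp, Real.exp_le_exp]
      gcongr
      exact (le_abs_self _).trans (hC S)
  have h1 := mul_meas_ge_le_integral_of_nonneg (μ := P)
    (Filter.Eventually.of_forall fun S => (Real.exp_pos (t * f S)).le) hint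
    (Real.exp (t * (E + s)))
  have h2 := integral_exp_mul_le_of_bounded_differences p c t f C hC hc
  have h3 : {S | Real.exp (t * (E + s)) ≤ Real.exp (t * f S)} = {S | E + s ≤ f S} := by
    ext S
    simp only [Set.mem_ofPred_eq, Real.exp_le_exp]
    exact mul_le_mul_iff_right₀ ht0
  rw [h3] at h1
  have h4 := h1.trans h2
  rw [mul_comm, ← le_div_iff₀ (Real.exp_pos _), ← Real.exp_sub] at h4
  refine h4.trans (le_of_eq ?_)
  congr 1
  rw [ht]
  field_simp
  ring

end boundedDifferences

section hypergraphs

variable {V : Type*}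

theorem abs_empFreq_sub_update_le {k m : ℕ} (hm : 1 ≤ m) (S : Fin m → V) (j : Fin m) (x : V)
    (g : Set (Fin k → V)) :
    |empFreq S g - empFreq (Function.update S j x) g| ≤ k / m := by
  classical
  have hm0 : (0 : ℝ) < m := by exact_mod_cast hm
  unfold empFreq
  rw [← sub_div, ← Finset.sum_sub_distrib, abs_div, abs_of_pos (show (0 : ℝ) < (m : ℝ) ^ k by
    positivity), div_le_iff₀ (by positivity)]
  have hterm : ∀ i : Fin k → Fin m, |g.indicator (fun _ => (1 : ℝ)) (fun l => S (i l))
      - g.indicator (fun _ => (1 : ℝ)) (fun l => Function.update S j x (i l))|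
      ≤ ∑ l, if i l = j then 1 else 0 := by
    intro i
    by_cases h : ∃ l, i l = j
    · obtain ⟨l, hl⟩ := h
      have h1 : (1 : ℝ) ≤ ∑ l, if i l = j then 1 else 0 := by
        refine le_trans ?_ (Finset.single_le_sum (f := fun l => if i l = j then (1 : ℝ) else 0)
          (fun l _ => by positivity) (Finset.mem_univ l))
        simp [hl]
      refine le_trans ?_ h1
      by_cases h2 : (fun l => S (i l)) ∈ g <;>
        by_cases h3 : (fun l => Function.update S j x (i l)) ∈ g <;> simp [h2, h3]
    · push Not at h
      have e : (fun l => Function.update S j x (i l)) = fun l => S (i l) := by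
        funext l
        rw [Function.update_of_ne (h l)]
      rw [e, sub_self, abs_zero]
      positivity
  refine (Finset.abs_sum_le_sum_abs _ _).trans ((Finset.sum_le_sum fun i _ => hterm i).trans ?_)
  rw [Finset.sum_comm]
  have hcount : ∀ l : Fin k, (∑ i : Fin k → Fin m, if i l = j then (1 : ℝ) else 0)
      = (m : ℝ) ^ k / m := by
    intro l
    have h := Fintype.card_filter_piFinset_const_eq_of_mem (Finset.univ : Finset (Fin m)) l
      (Finset.mem_univ j)
    rw [Fintype.piFinset_univ] at h
    rw [Finset.sum_boole, h, eq_div_iff hm0.ne']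
    have hk : k - 1 + 1 = k := Nat.sub_add_cancel (Fin.pos l)
    simp only [Finset.card_univ, Fintype.card_fin]
    push_cast
    rw [← pow_succ, hk]
  simp_rw [hcount]
  simp only [Finset.sum_const, Finset.card_univ, Fintype.card_fin, nsmul_eq_mul]
  exact le_of_eq (by ring)

theorem abs_freqDev_sub_update_le {Γ : Type*} [Nonempty Γ] [MeasurableSpace V] {k m : ℕ}
    (hm : 1 ≤ m) (p : Measure V) [IsProbabilityMeasure p] (g : Γ → Set (Fin k → V))
    (S : Fin m → V) (j : Fin m) (x : V) :
    |freqDev p g S - freqDev p g (Function.update S j x)| ≤ k / m := by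
  have h : ∀ a, |empFreq S (g a) - empFreq (Function.update S j x) (g a)| ≤ k / m := fun a =>
    abs_empFreq_sub_update_le hm S j x (g a)
  rw [abs_le]
  constructor
  · have := iSup_abs_le_add (φ := fun a => edgeFreq p (g a) - empFreq (Function.update S j x) (g a))
      (ψ := fun a => edgeFreq p (g a) - empFreq S (g a)) (c := k / m)
      (fun a => abs_freqDev_term_le p (g a) S) fun a => by
        rw [sub_sub_sub_cancel_left]; exact h a
    unfold freqDev
    linarith
  · have := iSup_abs_le_add (φ := fun a => edgeFreq p (g a) - empFreq S (g a))
      (ψ := fun a => edgeFreq p (g a) - empFreq (Function.update S j x) (g a)) (c := k / m)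
      (fun a => abs_freqDev_term_le p (g a) _) fun a => by
        rw [sub_sub_sub_cancel_left, abs_sub_comm]; exact h a
    unfold freqDev
    linarith

theorem VCdim_update_last_le_gVC : ∀ {k : ℕ} (G : Set (Set (Fin (k + 1) → V)))
    (w : Fin (k + 1) → V),
    VCdim ((fun g : Set (Fin (k + 1) → V) => {x | Function.update w (Fin.last k) x ∈ g}) '' G)
      ≤ gVC (k + 1) G
  | 0, G, w => by
    have e : ∀ x, Function.update w (Fin.last 0) x = fun _ => x := fun x => by
      funext i
      have hi : i = Fin.last 0 := by omega
      rw [hi, Function.update_self]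
    simp only [e]
    exact le_rfl
  | k + 1, G, w => by
    have h1 := VCdim_update_last_le_gVC (fixFirst (w 0) '' G) (Fin.tail w)
    have h2 : gVC (k + 1) (fixFirst (w 0) '' G) ≤ gVC (k + 1 + 1) G :=
      le_iSup (fun v => gVC (k + 1) (fixFirst v '' G)) (w 0)
    refine le_trans (le_of_eq ?_) (h1.trans h2)
    rw [Set.image_image]
    congr 1
    refine Set.image_congr fun g _ => ?_
    ext x
    simp only [fixFirst, Set.mem_ofPred_eq, Fin.cons_update, Fin.succ_last, Fin.cons_self_tail]

theorem Undirected.update_mem_iff {k : ℕ} {g : Set (Fin k → V)} (hg : Undirected g) (i j : Fin k)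
    (w : Fin k → V) (x : V) : Function.update w j x ∈ g ↔
      Function.update (fun l => w (Equiv.swap j i l)) i x ∈ g := by
  rw [← hg (Equiv.swap j i) (Function.update (fun l => w (Equiv.swap j i l)) i x)]
  have e : (fun l => Function.update (fun l => w (Equiv.swap j i l)) i x (Equiv.swap j i l))
      = Function.update w j x := by
    funext l
    by_cases h : l = j
    · subst h; simp
    · have h' : Equiv.swap j i l ≠ i := fun h2 => h (by
        have := congrArg (Equiv.swap j i) h2
        simpa using this)
      rw [Function.update_of_ne h', Function.update_of_ne h]
      simp
  rw [e]

theorem sectionsVCLE_of_gVC_le {k d : ℕ} {G : Set (Set (Fin k → V))}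
    (hG : IsDistinguishingClass G) (h : gVC k G ≤ d) :
    SectionsVCLE (fun g : G => (g : Set (Fin k → V))) d := by
  intro j w
  obtain _ | k := k
  · exact j.elim0
  refine le_trans (le_of_eq ?_)
    ((VCdim_update_last_le_gVC G fun l => w (Equiv.swap j (Fin.last k) l)).trans h)
  congr 1
  rw [Set.image_eq_range]
  congr 1
  funext g
  ext x
  exact (hG g g.2).update_mem_iff (Fin.last k) j w x

theorem subsingleton_of_sectionsVCLE_zero {k : ℕ} (hk : 1 ≤ k) {Γ : Type*}
    {g : Γ → Set (Fin k → V)} (h : SectionsVCLE g 0) (a b : Γ) : g a = g b := by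
  have key : ∀ a b : Γ, g a ⊆ g b := by
    intro a b w hw
    by_contra hwb
    let j : Fin k := ⟨0, hk⟩
    have hsh : ShattersSet (Set.range fun a => {x | Function.update w j x ∈ g a}) {w j} := by
      intro T hT
      rw [Finset.coe_singleton] at hT ⊢
      rcases Set.subset_singleton_iff_eq.1 hT with rfl | rfl
      · refine ⟨_, ⟨b, rfl⟩, ?_⟩
        rw [Set.inter_singleton_eq_empty]
        simpa using hwb
      · refine ⟨_, ⟨a, rfl⟩, ?_⟩
        rw [Set.inter_eq_right, Set.singleton_subset_iff]
        simpa using hw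
    have h1 := (le_iSup₂ (f := fun (S : Finset V) (_ : ShattersSet
      (Set.range fun a => {x | Function.update w j x ∈ g a}) S) => (S.card : ℕ∞))
      {w j} hsh).trans (h j w)
    simp at h1
  exact Set.Subset.antisymm (key a b) (key b a)

theorem exists_isEmpiricalMaximizer {k : ℕ} {G : Set (Set (Fin k → V))} (hG : G.Nonempty) :
    ∃ A : Algo V k, IsEmpiricalMaximizer G A := by
  have h : ∀ (m₁ m₂ : ℕ) (S₁ : Fin m₁ → V) (S₂ : Fin m₂ → V), ∃ g₀ ∈ G, ∀ g ∈ G,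
      |empFreq S₁ g - empFreq S₂ g| ≤ |empFreq S₁ g₀ - empFreq S₂ g₀| := by
    intro m₁ m₂ S₁ S₂
    have hfin : ∀ {m : ℕ} (S : Fin m → V),
        (Set.range fun g : Set (Fin k → V) => empFreq S g).Finite := by
      intro m S
      refine (Set.finite_range fun T : Set (Fin k → Fin m) =>
        (∑ i, T.indicator (fun _ => (1 : ℝ)) i) / (m : ℝ) ^ k).subset ?_
      rintro _ ⟨g, rfl⟩
      exact ⟨{i | (fun l => S (i l)) ∈ g}, rfl⟩
    have hfin2 : ((fun g => |empFreq S₁ g - empFreq S₂ g|) '' G).Finite := by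
      refine (((hfin S₁).prod (hfin S₂)).image fun q => |q.1 - q.2|).subset ?_
      rintro _ ⟨g, -, rfl⟩
      exact ⟨(empFreq S₁ g, empFreq S₂ g), ⟨⟨g, rfl⟩, ⟨g, rfl⟩⟩, rfl⟩
    obtain ⟨_, ⟨g₀, hg₀, rfl⟩, hmax⟩ := Set.exists_max_image _ id hfin2 (hG.image _)
    exact ⟨g₀, hg₀, fun g hg => hmax _ ⟨g, hg, rfl⟩⟩
  choose A hA hmax using h
  exact ⟨A, fun m₁ m₂ S₁ S₂ => ⟨hA m₁ m₂ S₁ S₂, hmax m₁ m₂ S₁ S₂⟩⟩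

theorem IPM_le_of_isEmpiricalMaximizer [MeasurableSpace V] {k : ℕ} {G : Set (Set (Fin k → V))}
    (hG : G.Nonempty) {A : Algo V k} (hA : IsEmpiricalMaximizer G A) (p₁ p₂ : Measure V)
    [IsProbabilityMeasure p₁] [IsProbabilityMeasure p₂] {m₁ m₂ : ℕ} (S₁ : Fin m₁ → V)
    (S₂ : Fin m₂ → V) :
    IPM G p₁ p₂ ≤ |edgeFreq p₁ (A m₁ m₂ S₁ S₂) - edgeFreq p₂ (A m₁ m₂ S₁ S₂)|
      + 2 * (freqDev p₁ (fun g : G => (g : Set (Fin k → V))) S₁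
        + freqDev p₂ (fun g : G => (g : Set (Fin k → V))) S₂) := by
  have : Nonempty G := hG.to_subtype
  have hdev : ∀ g ∈ G, |edgeFreq p₁ g - empFreq S₁ g|
        ≤ freqDev p₁ (fun g : G => (g : Set (Fin k → V))) S₁
      ∧ |edgeFreq p₂ g - empFreq S₂ g|
        ≤ freqDev p₂ (fun g : G => (g : Set (Fin k → V))) S₂ := fun g hg =>
    ⟨abs_le_iSup_abs (φ := fun g : G => edgeFreq p₁ (g : Set (Fin k → V)) - empFreq S₁ g.1)
      (fun a => abs_freqDev_term_le p₁ a.1 S₁) ⟨g, hg⟩,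
    abs_le_iSup_abs (φ := fun g : G => edgeFreq p₂ (g : Set (Fin k → V)) - empFreq S₂ g.1)
      (fun a => abs_freqDev_term_le p₂ a.1 S₂) ⟨g, hg⟩⟩
  refine ciSup_le fun g => ?_
  obtain ⟨hmem, hmax⟩ := hA m₁ m₂ S₁ S₂
  have h1 := hmax g g.2
  obtain ⟨h2, h3⟩ := hdev g g.2
  obtain ⟨h4, h5⟩ := hdev _ hmem
  set g₀ := A m₁ m₂ S₁ S₂
  have h6 : |edgeFreq p₁ (g : Set (Fin k → V)) - edgeFreq p₂ (g : Set (Fin k → V))|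
      ≤ |empFreq S₁ (g : Set (Fin k → V)) - empFreq S₂ (g : Set (Fin k → V))|
        + |edgeFreq p₁ (g : Set (Fin k → V)) - empFreq S₁ (g : Set (Fin k → V))|
        + |edgeFreq p₂ (g : Set (Fin k → V)) - empFreq S₂ (g : Set (Fin k → V))| := by
    grind
  have h7 : |empFreq S₁ g₀ - empFreq S₂ g₀| ≤ |edgeFreq p₁ g₀ - edgeFreq p₂ g₀|
      + |edgeFreq p₁ g₀ - empFreq S₁ g₀| + |edgeFreq p₂ g₀ - empFreq S₂ g₀| := by
    grind
  linarith

end hypergraphs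

section

variable {V : Type*} [Countable V] [MeasurableSpace V] [MeasurableSingletonClass V]

/-- Uniform convergence of the edge frequencies, with high probability. -/
theorem measureReal_freqDev_ge_le {Γ : Type*} [Nonempty Γ] {k d m : ℕ} (hk : 1 ≤ k) (hd : 1 ≤ d)
    (p : Measure V) [IsProbabilityMeasure p] (g : Γ → Set (Fin k → V)) (hg : SectionsVCLE g d)
    {ε δ : ℝ} (hε : 0 < ε) (hε1 : ε ≤ 1) (hδ : 0 < δ) (hδ2 : δ ≤ 1 / 2)
    (hm : 5000000 * ((d : ℝ) * (k : ℝ) ^ 2 / ε ^ 2 * Real.log (1 / δ)) < m) :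
    (Measure.pi fun _ : Fin m => p).real {S | ε / 4 ≤ freqDev p g S} ≤ δ / 2 := by
  have hk1 : (1 : ℝ) ≤ k := by exact_mod_cast hk
  have hd1 : (1 : ℝ) ≤ d := by exact_mod_cast hd
  have hL : Real.log 2 ≤ Real.log (1 / δ) := by
    refine Real.log_le_log (by norm_num) ?_
    rw [le_div_iff₀ hδ]
    linarith
  have hlog2 := Real.log_two_gt_d9
  set L := Real.log (1 / δ) with hLdef
  have hLhalf : 1 / 2 ≤ L := by linarith
  have hX : 5000000 * ((d : ℝ) * (k : ℝ) ^ 2 * L) < m * ε ^ 2 := by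
    have e : 5000000 * ((d : ℝ) * (k : ℝ) ^ 2 / ε ^ 2 * L)
        = 5000000 * ((d : ℝ) * (k : ℝ) ^ 2 * L) / ε ^ 2 := by ring
    rwa [e, div_lt_iff₀ (by positivity)] at hm
  have hm0 : (0 : ℝ) < m := lt_of_le_of_lt (by positivity) hm
  have hm1 : 1 ≤ m := by exact_mod_cast hm0
  have hkk : 0 < (k : ℝ) ^ 2 := by positivity
  have hdk : (k : ℝ) ^ 2 ≤ d * (k : ℝ) ^ 2 := le_mul_of_one_le_left hkk.le hd1
  have hdkL : (d : ℝ) * (k : ℝ) ^ 2 * (1 / 2) ≤ d * (k : ℝ) ^ 2 * L := by gcongr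
  have hkL : (k : ℝ) ^ 2 * L ≤ d * (k : ℝ) ^ 2 * L := by gcongr
  have hE : ∫ S, freqDev p g S ∂(Measure.pi fun _ : Fin m => p) ≤ ε / 8 := by
    refine (integral_freqDev_le hm1 hd p g hg).trans ?_
    have h1 : (k : ℝ) * Real.sqrt (d / m) ≤ ε / 1472 := by
      have e : (k : ℝ) * Real.sqrt (d / m) = Real.sqrt (k ^ 2 * (d / m)) := by
        rw [Real.sqrt_mul (by positivity), Real.sqrt_sq (by positivity)]
      rw [e, Real.sqrt_le_iff]
      refine ⟨by positivity, ?_⟩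
      rw [← mul_div_assoc, div_le_iff₀ hm0]
      nlinarith
    have h2 : (k : ℝ) * (k / m) ≤ ε / 16 := by
      rw [← mul_div_assoc, div_le_iff₀ hm0]
      have : ε ^ 2 ≤ ε := by nlinarith
      nlinarith
    linarith
  have hc0 : (0 : ℝ) < k / m := by positivity
  have h1 := measureReal_ge_le_of_bounded_differences hm1 p (f := freqDev p g) (C := 1)
    (c := k / m) (s := ε / 8) (fun S => abs_freqDev_le p g S) hc0 (by positivity)
    (fun S j x => abs_freqDev_sub_update_le hm1 p g S j x)
  have h2 : (Measure.pi fun _ : Fin m => p).real {S | ε / 4 ≤ freqDev p g S}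
      ≤ (Measure.pi fun _ : Fin m => p).real
        {S | ∫ S, freqDev p g S ∂(Measure.pi fun _ : Fin m => p) + ε / 8 ≤ freqDev p g S} := by
    refine measureReal_mono fun S hS => ?_
    simp only [Set.mem_ofPred_eq] at hS ⊢
    linarith
  refine h2.trans (h1.trans ?_)
  have h3 : δ / 2 = Real.exp (-(L + Real.log 2)) := by
    rw [hLdef, one_div, Real.log_inv, neg_add, neg_neg, Real.exp_add, Real.exp_log hδ,
      Real.exp_neg, Real.exp_log (by norm_num)]
    ring
  rw [h3, Real.exp_le_exp, neg_le_neg_iff]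
  have e : (ε / 8) ^ 2 / (2 * (m * (k / m) ^ 2)) = m * ε ^ 2 / (128 * (k : ℝ) ^ 2) := by
    field_simp
    norm_num
  rw [e, le_div_iff₀ (by positivity)]
  have h4 : (L + Real.log 2) * (128 * (k : ℝ) ^ 2) ≤ (L + L) * (128 * (k : ℝ) ^ 2) := by gcongr
  nlinarith

theorem IsEmpiricalMaximizer.discriminates {k : ℕ} (hk : 1 ≤ k) {G : Set (Set (Fin k → V))}
    (hG : G.Nonempty) (hGu : IsDistinguishingClass G) {ρ : ℕ} (hρ : gVC k G = (ρ : ℕ∞))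
    {A : Algo V k} (hA : IsEmpiricalMaximizer G A) {ε δ : ℝ} (hε : 0 < ε) (hδ : 0 < δ)
    (hδ2 : δ ≤ 1 / 2) :
    Discriminates G A ε δ
      (5000000 * ((ρ : ℝ) * (k : ℝ) ^ 2 / ε ^ 2 * Real.log (1 / δ))) := by
  have : Nonempty G := hG.to_subtype
  refine ⟨fun m₁ m₂ S₁ S₂ => (hA m₁ m₂ S₁ S₂).1, fun p₁ p₂ hp₁ hp₂ m₁ m₂ hm₁ hm₂ => ?_⟩
  have hsec := sectionsVCLE_of_gVC_le hGu hρ.le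
  set Q := (Measure.pi fun _ : Fin m₁ => p₁).prod (Measure.pi fun _ : Fin m₂ => p₂) with hQ
  have huniv : (∀ (S₁ : Fin m₁ → V) (S₂ : Fin m₂ → V), IPM G p₁ p₂ - ε
      < |edgeFreq p₁ (A m₁ m₂ S₁ S₂) - edgeFreq p₂ (A m₁ m₂ S₁ S₂)|) →
      1 - δ ≤ Q.real {S : (Fin m₁ → V) × (Fin m₂ → V) | IPM G p₁ p₂ - ε <
            |edgeFreq p₁ (A m₁ m₂ S.1 S.2) - edgeFreq p₂ (A m₁ m₂ S.1 S.2)|} := by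
    intro h
    have e : {S : (Fin m₁ → V) × (Fin m₂ → V) | IPM G p₁ p₂ - ε <
            |edgeFreq p₁ (A m₁ m₂ S.1 S.2) - edgeFreq p₂ (A m₁ m₂ S.1 S.2)|} = Set.univ :=
      Set.eq_univ_of_forall fun S => h S.1 S.2
    rw [e, probReal_univ]
    linarith
  rcases Nat.eq_zero_or_pos ρ with rfl | hρ1
  · refine huniv fun S₁ S₂ => ?_
    have h : IPM G p₁ p₂ ≤ |edgeFreq p₁ (A m₁ m₂ S₁ S₂) - edgeFreq p₂ (A m₁ m₂ S₁ S₂)| := by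
      refine ciSup_le fun g => ?_
      have e := subsingleton_of_sectionsVCLE_zero hk hsec g ⟨_, (hA m₁ m₂ S₁ S₂).1⟩
      simp only at e
      rw [e]
    linarith
  rcases lt_or_ge 1 ε with hε1 | hε1
  · refine huniv fun S₁ S₂ => ?_
    have h : IPM G p₁ p₂ ≤ 1 := ciSup_le fun g =>
      abs_sub_le_one (edgeFreq_mem_Icc p₁ _) (edgeFreq_mem_Icc p₂ _)
    have := abs_nonneg (edgeFreq p₁ (A m₁ m₂ S₁ S₂) - edgeFreq p₂ (A m₁ m₂ S₁ S₂))
    linarith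
  set γ : G → Set (Fin k → V) := fun g => g with hγ
  have hb₁ := measureReal_freqDev_ge_le hk hρ1 p₁ γ hsec hε hε1 hδ hδ2 hm₁
  have hb₂ := measureReal_freqDev_ge_le hk hρ1 p₂ γ hsec hε hε1 hδ hδ2 hm₂
  set B₁ := {S : Fin m₁ → V | ε / 4 ≤ freqDev p₁ γ S} with hB₁
  set B₂ := {S : Fin m₂ → V | ε / 4 ≤ freqDev p₂ γ S} with hB₂
  have hbad : Q.real (Prod.fst ⁻¹' B₁ ∪ Prod.snd ⁻¹' B₂) ≤ δ := by
    refine (measureReal_union_le _ _).trans ?_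
    rw [hQ, measurePreserving_fst.measureReal_preimage (MeasurableSet.of_discrete.nullMeasurableSet),
      measurePreserving_snd.measureReal_preimage (MeasurableSet.of_discrete.nullMeasurableSet)]
    linarith
  calc 1 - δ ≤ 1 - Q.real (Prod.fst ⁻¹' B₁ ∪ Prod.snd ⁻¹' B₂) := by linarith
    _ = Q.real (Prod.fst ⁻¹' B₁ ∪ Prod.snd ⁻¹' B₂)ᶜ :=
        (probReal_compl_eq_one_sub .of_discrete).symm
    _ ≤ _ := by
        refine measureReal_mono fun S hS => ?_
        have hS' : ¬ (ε / 4 ≤ freqDev p₁ γ S.1 ∨ ε / 4 ≤ freqDev p₂ γ S.2) := hS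
        push Not at hS'
        have := IPM_le_of_isEmpiricalMaximizer hG hA p₁ p₂ S.1 S.2
        simp only [Set.mem_ofPred_eq]
        linarith [hS'.1, hS'.2]

end

end GraphDisc

theorem mainTheorem5 :
    ∃ C : ℝ, 0 < C ∧
      ∀ (V : Type*) [Countable V] [MeasurableSpace V] [MeasurableSingletonClass V]
        (k : ℕ) (_ : 1 ≤ k) (G : Set (Set (Fin k → V))) (_ : G.Nonempty)
        (_ : GraphDisc.IsDistinguishingClass G) (ρ : ℕ) (_ : GraphDisc.gVC k G = (ρ : ℕ∞)),
        (∀ ε δ : ℝ, 0 < ε → 0 < δ → δ ≤ 1 / 2 →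
          ((GraphDisc.sampleComplexity G ε δ : ℕ∞) : ℝ≥0∞) ≤
            ENNReal.ofReal (C * ((ρ : ℝ) * (k : ℝ) ^ 2 / ε ^ 2 * Real.log (1 / δ)))) ∧
        (∃ A : GraphDisc.Algo V k, GraphDisc.IsEmpiricalMaximizer G A) ∧
        (∀ A : GraphDisc.Algo V k, GraphDisc.IsEmpiricalMaximizer G A →
          ∀ ε δ : ℝ, 0 < ε → 0 < δ → δ ≤ 1 / 2 →
            GraphDisc.Discriminates G A ε δ
              (C * ((ρ : ℝ) * (k : ℝ) ^ 2 / ε ^ 2 * Real.log (1 / δ)))) := by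
  refine ⟨5000000, by norm_num, ?_⟩
  intro V _ _ _ k hk G hG hGu ρ hρ
  obtain ⟨A, hA⟩ := GraphDisc.exists_isEmpiricalMaximizer hG
  refine ⟨fun ε δ hε hδ hδ2 => ?_, ⟨A, hA⟩, fun A hA ε δ hε hδ hδ2 =>
    hA.discriminates hk hG hGu hρ hε hδ hδ2⟩
  have hD := hA.discriminates hk hG hGu hρ hε hδ hδ2
  set X := 5000000 * ((ρ : ℝ) * (k : ℝ) ^ 2 / ε ^ 2 * Real.log (1 / δ)) with hX
  have hX0 : 0 ≤ X := by
    have : 0 ≤ Real.log (1 / δ) := Real.log_nonneg (by rw [le_div_iff₀ hδ]; linarith)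
    positivity
  have hfloor : GraphDisc.Discriminates G A ε δ (⌊X⌋₊ : ℝ) :=
    ⟨hD.1, fun p₁ p₂ h₁ h₂ m₁ m₂ hm₁ hm₂ => hD.2 p₁ p₂ h₁ h₂ m₁ m₂
      ((Nat.floor_lt hX0).1 (by exact_mod_cast hm₁)) ((Nat.floor_lt hX0).1 (by exact_mod_cast hm₂))⟩
  have hle : GraphDisc.sampleComplexity G ε δ ≤ (⌊X⌋₊ : ℕ∞) :=
    iInf₂_le (f := fun (m : ℕ) (_ : ∃ A : GraphDisc.Algo V k,
      GraphDisc.Discriminates G A ε δ m) => (m : ℕ∞)) ⌊X⌋₊ ⟨A, hfloor⟩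
  calc ((GraphDisc.sampleComplexity G ε δ : ℕ∞) : ℝ≥0∞) ≤ (((⌊X⌋₊ : ℕ) : ℕ∞) : ℝ≥0∞) :=
        ENat.toENNReal_mono hle
    _ = ENNReal.ofReal (⌊X⌋₊ : ℝ) := by rw [ENat.toENNReal_coe, ENNReal.ofReal_natCast]
    _ ≤ ENNReal.ofReal X := ENNReal.ofReal_le_ofReal (Nat.floor_le hX0)
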